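/- Let $A$ range over Grassmann algebras $\Lambda\mathbb{R}^n$, $n\ge 0$. A supermanifold $M$ is regarded as a functor $A\mapsto M_A$ from Grassmann algebras to (second countable Hausdorff) manifolds with an atlas modelled on superdomains, and maps of supermanifolds are natural transformations with smooth components whose derivatives are $A_0$-linear. A supergroup is a group object in supermanifolds, so that $G_A$ is a group for each $A$. Let $G$ be a supergroup acting by automorphisms on an abelian supergroup $H$, that is, let $\alpha\colon G\times H\to H$ be a map of supermanifolds inducing for each $A$ an action of $G_A$ on $H_A$ by group automorphisms, written $(g,h)\mapsto gh$. Let $\pi\colon G^4\to H$ be a map of supermanifolds which is normalized: $\pi(g_1,g_2,g_3,g_4)=0$ for all $A$-points with some $g_i=1$. It is a 4-cocycle if for all $A$ and all $g_1,\dots,g_5\in G_A$ $$g_1\pi(g_2,g_3,g_4,g_5)-\pi(g_1g_2,g_3,g_4,g_5)+\pi(g_1,g_2g_3,g_4,g_5)-\pi(g_1,g_2,g_3g_4,g_5)+\pi(g_1,g_2,g_3,g_4g_5)-\pi(g_1,g_2,g_3,g_4)=0 .$$ A super tricategory consists of supermanifolds $T_0,T_1,T_2,T_3$ of objects, morphisms,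 2-morphisms and 3-morphisms, with source and target maps, and for each $A$ the structure of a tricategory on the $A$-points of $T_0,\dots,T_3$ (satisfying the pentagonator identity and the two normalization axioms), such that all structure maps (identities, compositions at 0-, 1- and 2-cells with their constraint cells, associator, left and right unitors, pentagonator, triangulators) are maps of supermanifolds, the sets of composable tuples being the $A$-points of supermanifolds that are pullbacks. A 3-supergroup is a super tricategory whose supermanifold of objects is a single point, together with maps of supermanifolds choosing an inverse $\mathrm{inv}_3(\Gamma)$ of each 3-morphism, an adjoint equivalence $(\alpha,\alpha^{-1},e,u)$ for each 2-morphism $\alpha$, and a biadjoint biequivalence $(f,f^{-1},\epsilon,\eta,\Phi,\Theta)$, satisfying the swallowtail identity, for each morphism $f$; here $\Phi$ and $\Theta$ are invertible 3-morphisms from the identities of $f$ and of $f^{-1}$ to the two zig-zag composites of $\eta$ and $\epsilon$. The slim construction $\mathrm{Brane}_\pi(G,H)$ has the following data, on $A$-points. $T_0$ is the one-point supermanifold, $T_1=T_2=G$ and $T_3=G\times H$. The source and target maps are $G\to 1$, $\mathrm{id}_G$ and the projection $G\times H\to G$; the identities are $1\in G$, $\mathrm{id}_G$ and $g\mapsto(g,0)$.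 Composition at a 0-cell is multiplication in $G$, in $G$ and in $G\ltimes H$, that is, $(g,h)(g',h')=(gg',h+gh')$; composition of 2-morphisms at a 1-cell is trivial; composition of 3-morphisms at a 1-cell and at a 2-cell is addition in $H$. The pentagonator is $\pi$, that is, its value at $(f,g,h,k)$ is the 3-morphism $(fghk,\pi(f,g,h,k))$. The associator, the unitors and the triangulators, and all other constraint cells, are trivial. The inverses are $\mathrm{inv}_3(g,h)=(g,-h)$, trivial for 2-morphisms, and $\mathrm{inv}_1(g)=g^{-1}$ with $\epsilon,\eta$ trivial, $\Phi(g)=-\pi(g,g^{-1},g,g^{-1})$ and $\Theta(g)=0$. **Proposition.** If $\pi$ is a 4-cocycle, then $\mathrm{Brane}_\pi(G,H)$ is a 3-supergroup: a super tricategory with one object and all morphisms, 2-morphisms and 3-morphisms weakly invertible. Conversely, if these data form a 3-supergroup, then $\pi$ is a 4-cocycle. (The pentagonator identity, on $A$-points, is the cocycle condition.) -/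

import Mathlib

open CategoryTheory Bicategory
open scoped ContDiff CategoryTheory.Pseudofunctor.StrongTrans

universe u

noncomputable section

namespace SuperGeometry

/-! ### Grassmann algebras -/

/-- The Grassmann algebra `Λ ℝⁿ`. -/
def Gr (n : ℕ) : Type := ExteriorAlgebra ℝ (Fin n → ℝ)

instance (n : ℕ) : Ring (Gr n) := inferInstanceAs (Ring (ExteriorAlgebra ℝ (Fin n → ℝ)))

instance (n : ℕ) : Algebra ℝ (Gr n) :=
  inferInstanceAs (Algebra ℝ (ExteriorAlgebra ℝ (Fin n → ℝ)))

namespace Gr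

/-- Coordinates with respect to the basis of monomials in the generators. -/
def coord (n : ℕ) : Gr n ≃ₗ[ℝ] (Finset (Fin n) → ℝ) :=
  (Pi.basisFun ℝ (Fin n)).ExteriorAlgebra.equivFun

/-- The finite-dimensional vector space `Λ ℝⁿ` is given the sup norm of the coordinates; only the
resulting topology and smooth structure matter, and they do not depend on the norm. -/
instance (n : ℕ) : NormedAddCommGroup (Gr n) :=
  NormedAddCommGroup.induced (Gr n) (Finset (Fin n) → ℝ) (coord n).toLinearMap (coord n).injective

instance (n : ℕ) : NormedSpace ℝ (Gr n) :=
  NormedSpace.induced ℝ (Gr n) (Finset (Fin n) → ℝ) (coord n).toLinearMap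

/-- The even part `A₀` (`i = 0`) and the odd part `A₁` (`i = 1`) of `A = Λ ℝⁿ`. -/
def part (n : ℕ) (i : ZMod 2) : Submodule ℝ (Gr n) :=
  CliffordAlgebra.evenOdd (0 : QuadraticForm ℝ (Fin n → ℝ)) i

theorem mul_mem_part {n : ℕ} {i : ZMod 2} {a x : Gr n} (ha : a ∈ part n 0) (hx : x ∈ part n i) :
    a * x ∈ part n i := by
  have h : a * x ∈ part n (0 + i) :=
    CliffordAlgebra.evenOdd_mul_le _ 0 i (Submodule.mul_mem_mul ha hx)
  rwa [zero_add] at h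

/-- The projection `ε_A : A → ℝ` killing all nilpotent elements. -/
def aug (n : ℕ) : Gr n →ₐ[ℝ] ℝ := ExteriorAlgebra.algebraMapInv

end Gr

/-- Homomorphisms of Grassmann algebras: grade-preserving algebra homomorphisms. -/
structure GrHom (m n : ℕ) where
  toAlgHom : Gr m →ₐ[ℝ] Gr n
  map_part : ∀ (i : ZMod 2) (x : Gr m), x ∈ Gr.part m i → toAlgHom x ∈ Gr.part n i

namespace GrHom

def id (n : ℕ) : GrHom n n := ⟨AlgHom.id ℝ (Gr n), fun _ _ h => h⟩

def comp {l m n : ℕ} (g : GrHom m n) (f : GrHom l m) : GrHom l n :=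
  ⟨g.toAlgHom.comp f.toAlgHom, fun i x h => g.map_part i _ (f.map_part i x h)⟩

/-- The restriction of a homomorphism to the even or the odd part. -/
def onPart {m n : ℕ} (f : GrHom m n) (i : ZMod 2) (x : Gr.part m i) : Gr.part n i :=
  ⟨f.toAlgHom x, f.map_part i x x.2⟩

end GrHom

/-! ### Super vector spaces, superdomains and smooth maps between them -/

/-- The `A`-points `V_A = A₀ ⊗ V₀ ⊕ A₁ ⊗ V₁` of the finite-dimensional super vector space `V` with
a basis of even vectors indexed by `ι` and a basis of odd vectors indexed by `κ`, for `A = Λ ℝⁿ`. -/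
abbrev VPts (ι κ : Type) (n : ℕ) : Type := (ι → Gr.part n 0) × (κ → Gr.part n 1)

namespace VPts

variable {ι κ ι' κ' : Type}

/-- The `A₀`-module structure of `V_A`. -/
def evenSMul {n : ℕ} (a : Gr.part n 0) (v : VPts ι κ n) : VPts ι κ n :=
  (fun i => ⟨(a : Gr n) * (v.1 i : Gr n), Gr.mul_mem_part a.2 (v.1 i).2⟩,
   fun k => ⟨(a : Gr n) * (v.2 k : Gr n), Gr.mul_mem_part a.2 (v.2 k).2⟩)

/-- The map `V_f : V_A → V_B` induced by `f : A → B`. -/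
def map {m n : ℕ} (f : GrHom m n) (v : VPts ι κ m) : VPts ι κ n :=
  (fun i => f.onPart 0 (v.1 i), fun k => f.onPart 1 (v.2 k))

/-- The body of an `A`-point, an element of `V₀ = ℝ^ι`. -/
def body {n : ℕ} (v : VPts ι κ n) : ι → ℝ := fun i => Gr.aug n (v.1 i : Gr n)

variable [Fintype ι] [Fintype κ] [Fintype ι'] [Fintype κ']

/-- `A₀`-smoothness on a set `s` of `A`-points: smooth, with `A₀`-linear derivative at each point
of `s`. It is only used for open `s`. -/
def SmoothOn {n : ℕ} (φ : VPts ι κ n → VPts ι' κ' n) (s : Set (VPts ι κ n)) : Prop :=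
  ContDiffOn ℝ ∞ φ s ∧ ∀ x ∈ s, ∃ D : VPts ι κ n →L[ℝ] VPts ι' κ' n,
    HasFDerivAt φ D x ∧ ∀ (a : Gr.part n 0) (v : VPts ι κ n), D (evenSMul a v) = evenSMul a (D v)

end VPts

/-! ### Supermanifolds -/

/-- A supermanifold: a functor from Grassmann algebras to (second countable Hausdorff) manifolds,
with an atlas of charts, natural in the Grassmann algebra, onto superdomains of a fixed super vector
space, whose transition functions are smooth maps of superdomains. The smooth structure of `pts n`
is the one given by the charts; the maps `map f` are automatically smooth, as they are linear in
charts. -/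
structure SuperManifold where
  /-- the manifold `M_A` of `A`-points for `A = Λ ℝⁿ` -/
  pts : ℕ → Type u
  [top : ∀ n, TopologicalSpace (pts n)]
  [t2 : ∀ n, T2Space (pts n)]
  [sc : ∀ n, SecondCountableTopology (pts n)]
  map : ∀ {m n : ℕ}, GrHom m n → pts m → pts n
  map_id : ∀ (n : ℕ) (x : pts n), map (GrHom.id n) x = x
  map_comp : ∀ {l m n : ℕ} (f : GrHom l m) (g : GrHom m n) (x : pts l),
    map (g.comp f) x = map g (map f x)
  /-- index types of the homogeneous basis of the model super vector space -/
  ev : Type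
  od : Type
  [evFin : Fintype ev]
  [odFin : Fintype od]
  /-- index set of the atlas -/
  Idx : Type u
  chart : Idx → ∀ n, OpenPartialHomeomorph (pts n) (VPts ev od n)
  chart_cover : ∀ (n : ℕ) (x : pts n), ∃ a, x ∈ (chart a n).source
  /-- the image of each chart is a superdomain -/
  chart_target : ∀ a, ∃ U : Set (ev → ℝ), IsOpen U ∧ ∀ n, (chart a n).target = VPts.body ⁻¹' U
  /-- naturality of the charts -/
  chart_map : ∀ (a : Idx) {m n : ℕ} (f : GrHom m n) (x : pts m), x ∈ (chart a m).source →
    map f x ∈ (chart a n).source ∧ chart a n (map f x) = VPts.map f (chart a m x)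
  /-- the transition functions are defined on superdomains -/
  overlap : ∀ a b, ∃ U : Set (ev → ℝ), IsOpen U ∧
    ∀ n, ((chart a n).symm.trans (chart b n)).source = VPts.body ⁻¹' U
  transition_smooth : ∀ a b n, VPts.SmoothOn ((chart a n).symm.trans (chart b n))
    ((chart a n).symm.trans (chart b n)).source

attribute [instance] SuperManifold.top SuperManifold.t2 SuperManifold.sc SuperManifold.evFin
  SuperManifold.odFin

/-- A smooth map of supermanifolds: a natural transformation with `A₀`-smooth components. -/
structure SMap (M N : SuperManifold.{u}) where
  toFun : ∀ n, M.pts n → N.pts n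
  naturality : ∀ {m n : ℕ} (f : GrHom m n) (x : M.pts m), toFun n (M.map f x) = N.map f (toFun m x)
  cont : ∀ n, Continuous (toFun n)
  smooth : ∀ a b n, VPts.SmoothOn (fun v => N.chart b n (toFun n ((M.chart a n).symm v)))
    ((M.chart a n).target ∩ {v | toFun n ((M.chart a n).symm v) ∈ (N.chart b n).source})

instance (M N : SuperManifold.{u}) : CoeFun (SMap M N) (fun _ => ∀ n, M.pts n → N.pts n) :=
  ⟨SMap.toFun⟩


theorem SMap.ext' {M N : SuperManifold.{u}} {φ ψ : SMap M N} (h : ∀ n x, φ n x = ψ n x) :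
    φ = ψ := by
  cases φ; cases ψ
  congr
  funext n x
  exact h n x

/-- The identity map. -/
def SMap.id (M : SuperManifold.{u}) : SMap M M where
  toFun _ x := x
  naturality _ _ := rfl
  cont _ := continuous_id
  smooth a b n := by
    have h := M.transition_smooth a b n
    rw [OpenPartialHomeomorph.trans_source] at h
    exact h

/-! ### The one-point supermanifold and products -/

instance (n : ℕ) : Unique (VPts Empty Empty n) :=
  { default := (fun i => i.elim, fun i => i.elim)
    uniq := fun _ => Prod.ext (funext fun i => i.elim) (funext fun i => i.elim) }

/-- The one-point supermanifold, the supermanifold associated to `ℝ^{0|0}`. -/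
def SuperManifold.point : SuperManifold.{u} where
  pts _ := PUnit
  map _ x := x
  map_id _ _ := rfl
  map_comp _ _ _ := rfl
  ev := Empty
  od := Empty
  Idx := PUnit
  chart _ n := (Homeomorph.homeomorphOfUnique PUnit (VPts Empty Empty n)).toOpenPartialHomeomorph
  chart_cover _ _ := ⟨PUnit.unit, trivial⟩
  chart_target _ := ⟨Set.univ, isOpen_univ, fun _ => rfl⟩
  chart_map _ _ _ _ _ _ := ⟨trivial, Subsingleton.elim _ _⟩
  overlap _ _ := ⟨Set.univ, isOpen_univ, fun n => by
    ext; simp⟩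
  transition_smooth _ _ n := ⟨(contDiff_of_subsingleton
    (E := VPts Empty Empty n) (F := VPts Empty Empty n)).contDiffOn, fun x _ =>
    ⟨0, hasFDerivAt_of_subsingleton (E := VPts Empty Empty n) _ _, fun _ _ =>
      Subsingleton.elim (α := VPts Empty Empty n) _ _⟩⟩

/-- The map to the one-point supermanifold. -/
def SMap.toPoint (M : SuperManifold.{u}) : SMap M SuperManifold.point where
  toFun _ _ := PUnit.unit
  naturality _ _ := rfl
  cont _ := continuous_const
  smooth a b n := by
    refine ⟨?_, fun x _ => ⟨0, ?_, fun _ _ => Subsingleton.elim (α := VPts Empty Empty n) _ _⟩⟩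
    · exact contDiffOn_const
    · exact hasFDerivAt_const _ _

namespace VPts

variable {ι κ ι' κ' : Type} [Fintype ι] [Fintype κ] [Fintype ι'] [Fintype κ']

/-- The identification of `V_A × W_A` with `(V ⊕ W)_A`. -/
def prodEquiv (ι κ ι' κ' : Type) [Fintype ι] [Fintype κ] [Fintype ι'] [Fintype κ'] (n : ℕ) :
    (VPts ι κ n × VPts ι' κ' n) ≃L[ℝ] VPts (ι ⊕ ι') (κ ⊕ κ') n :=
  (ContinuousLinearEquiv.prodProdProdComm ℝ (ι → Gr.part n 0) (κ → Gr.part n 1)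
    (ι' → Gr.part n 0) (κ' → Gr.part n 1)).trans
  ((ContinuousLinearEquiv.sumPiEquivProdPi ℝ ι ι' (fun _ => Gr.part n 0)).symm.prodCongr
    (ContinuousLinearEquiv.sumPiEquivProdPi ℝ κ κ' (fun _ => Gr.part n 1)).symm)

theorem prodEquiv_evenSMul {n : ℕ} (a : Gr.part n 0) (v : VPts ι κ n) (w : VPts ι' κ' n) :
    prodEquiv ι κ ι' κ' n (evenSMul a v, evenSMul a w) =
      evenSMul a (prodEquiv ι κ ι' κ' n (v, w)) := by
  refine Prod.ext ?_ ?_ <;> funext i <;> cases i <;> rfl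

theorem prodEquiv_symm_evenSMul {n : ℕ} (a : Gr.part n 0) (v : VPts (ι ⊕ ι') (κ ⊕ κ') n) :
    (prodEquiv ι κ ι' κ' n).symm (evenSMul a v) =
      (evenSMul a ((prodEquiv ι κ ι' κ' n).symm v).1,
        evenSMul a ((prodEquiv ι κ ι' κ' n).symm v).2) := rfl

theorem prodEquiv_map {m n : ℕ} (f : GrHom m n) (v : VPts ι κ m) (w : VPts ι' κ' m) :
    prodEquiv ι κ ι' κ' n (map f v, map f w) = map f (prodEquiv ι κ ι' κ' m (v, w)) := by
  refine Prod.ext ?_ ?_ <;> funext i <;> cases i <;> rfl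

/-- The body of a product set. -/
theorem preimage_body_prod (n : ℕ) (U : Set (ι → ℝ)) (U' : Set (ι' → ℝ)) :
    (prodEquiv ι κ ι' κ' n).symm ⁻¹' ((body ⁻¹' U) ×ˢ (body ⁻¹' U')) =
      body ⁻¹' ((fun x : ι ⊕ ι' → ℝ => (fun i => x (Sum.inl i), fun i => x (Sum.inr i))) ⁻¹'
        (U ×ˢ U')) := rfl

theorem isOpen_sum {ι ι' : Type} {U : Set (ι → ℝ)} {U' : Set (ι' → ℝ)} (hU : IsOpen U) (hU' : IsOpen U') :
    IsOpen ((fun x : ι ⊕ ι' → ℝ => (fun i => x (Sum.inl i), fun i => x (Sum.inr i))) ⁻¹'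
      (U ×ˢ U')) :=
  (hU.prod hU').preimage (by fun_prop)

theorem SmoothOn.prod {ι₁ κ₁ ι₂ κ₂ : Type} [Fintype ι₁] [Fintype κ₁] [Fintype ι₂] [Fintype κ₂]
    {n : ℕ} {φ : VPts ι κ n → VPts ι₁ κ₁ n}
    {ψ : VPts ι' κ' n → VPts ι₂ κ₂ n} {s : Set (VPts ι κ n)} {t : Set (VPts ι' κ' n)}
    (hφ : SmoothOn φ s) (hψ : SmoothOn ψ t) :
    SmoothOn (fun v => prodEquiv ι₁ κ₁ ι₂ κ₂ n (φ ((prodEquiv ι κ ι' κ' n).symm v).1,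
        ψ ((prodEquiv ι κ ι' κ' n).symm v).2))
      ((prodEquiv ι κ ι' κ' n).symm ⁻¹' (s ×ˢ t)) := by
  constructor
  · refine (prodEquiv ι₁ κ₁ ι₂ κ₂ n).contDiff.comp_contDiffOn ?_
    refine ContDiffOn.prodMk ?_ ?_
    · exact hφ.1.comp (contDiff_fst.comp (prodEquiv ι κ ι' κ' n).symm.contDiff).contDiffOn
        (fun v hv => hv.1)
    · exact hψ.1.comp (contDiff_snd.comp (prodEquiv ι κ ι' κ' n).symm.contDiff).contDiffOn
        (fun v hv => hv.2)
  · rintro x ⟨hx, hx'⟩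
    obtain ⟨D, hD, hDa⟩ := hφ.2 _ hx
    obtain ⟨E, hE, hEa⟩ := hψ.2 _ hx'
    let e : VPts (ι ⊕ ι') (κ ⊕ κ') n →L[ℝ] VPts ι κ n × VPts ι' κ' n :=
      (prodEquiv ι κ ι' κ' n).symm.toContinuousLinearMap
    let e' : VPts ι₁ κ₁ n × VPts ι₂ κ₂ n →L[ℝ] VPts (ι₁ ⊕ ι₂) (κ₁ ⊕ κ₂) n :=
      (prodEquiv ι₁ κ₁ ι₂ κ₂ n).toContinuousLinearMap
    have he : HasFDerivAt (fun v => (prodEquiv ι κ ι' κ' n).symm v) e x := e.hasFDerivAt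
    refine ⟨e'.comp ((D.comp
      ((ContinuousLinearMap.fst ℝ _ _).comp e)).prod (E.comp
      ((ContinuousLinearMap.snd ℝ _ _).comp e))), ?_, ?_⟩
    · refine e'.hasFDerivAt.comp x ?_
      exact (hD.comp x he.fst).prodMk (hE.comp x he.snd)
    · intro a v
      change prodEquiv ι₁ κ₁ ι₂ κ₂ n (D (evenSMul a (e v).1), E (evenSMul a (e v).2)) = _
      rw [hDa, hEa, prodEquiv_evenSMul]
      rfl

end VPts

namespace SuperManifold

variable (M N : SuperManifold.{u})

/-- Product charts. -/
def prodChart (a : M.Idx × N.Idx) (n : ℕ) : OpenPartialHomeomorph (M.pts n × N.pts n)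
    (VPts (M.ev ⊕ N.ev) (M.od ⊕ N.od) n) :=
  ((M.chart a.1 n).prod (N.chart a.2 n)).transHomeomorph
    (VPts.prodEquiv M.ev M.od N.ev N.od n).toHomeomorph

theorem prodChart_trans_source (a b : M.Idx × N.Idx) (n : ℕ) :
    ((M.prodChart N a n).symm.trans (M.prodChart N b n)).source =
      (VPts.prodEquiv M.ev M.od N.ev N.od n).symm ⁻¹'
        (((M.chart a.1 n).symm.trans (M.chart b.1 n)).source ×ˢ
          ((N.chart a.2 n).symm.trans (N.chart b.2 n)).source) := by
  ext v
  simp only [OpenPartialHomeomorph.trans_source, Set.mem_inter_iff, Set.mem_preimage,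
    Set.mem_prod, OpenPartialHomeomorph.symm_source]
  exact ⟨fun h => ⟨⟨h.1.1, h.2.1⟩, h.1.2, h.2.2⟩, fun h => ⟨⟨h.1.1, h.2.1⟩, h.1.2, h.2.2⟩⟩

/-- The product of two supermanifolds; `(M × N)_A = M_A × N_A`. -/
def prod : SuperManifold.{u} where
  pts n := M.pts n × N.pts n
  map f x := (M.map f x.1, N.map f x.2)
  map_id n x := Prod.ext (M.map_id n x.1) (N.map_id n x.2)
  map_comp f g x := Prod.ext (M.map_comp f g x.1) (N.map_comp f g x.2)
  ev := M.ev ⊕ N.ev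
  od := M.od ⊕ N.od
  Idx := M.Idx × N.Idx
  chart a n := M.prodChart N a n
  chart_cover n x := by
    obtain ⟨a, ha⟩ := M.chart_cover n x.1
    obtain ⟨b, hb⟩ := N.chart_cover n x.2
    exact ⟨(a, b), ha, hb⟩
  chart_target a := by
    obtain ⟨U, hU, h⟩ := M.chart_target a.1
    obtain ⟨U', hU', h'⟩ := N.chart_target a.2
    refine ⟨_, VPts.isOpen_sum hU hU', fun n => ?_⟩
    rw [← VPts.preimage_body_prod, ← h n, ← h' n]
    rfl
  chart_map a m n f x hx := by
    obtain ⟨h1, h2⟩ := M.chart_map a.1 f x.1 hx.1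
    obtain ⟨h1', h2'⟩ := N.chart_map a.2 f x.2 hx.2
    refine ⟨⟨h1, h1'⟩, ?_⟩
    change VPts.prodEquiv _ _ _ _ n (M.chart a.1 n _, N.chart a.2 n _) = _
    rw [h2, h2', VPts.prodEquiv_map]
    rfl
  overlap a b := by
    obtain ⟨U, hU, h⟩ := M.overlap a.1 b.1
    obtain ⟨U', hU', h'⟩ := N.overlap a.2 b.2
    refine ⟨_, VPts.isOpen_sum hU hU', fun n => ?_⟩
    rw [prodChart_trans_source, ← VPts.preimage_body_prod, h n, h' n]
  transition_smooth a b n := by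
    rw [prodChart_trans_source]
    exact (M.transition_smooth a.1 b.1 n).prod (N.transition_smooth a.2 b.2 n)

end SuperManifold

/-- The first projection. -/
def SMap.fst (M N : SuperManifold.{u}) : SMap (M.prod N) M where
  toFun _ x := x.1
  naturality _ _ := rfl
  cont _ := continuous_fst
  smooth a b n := by
    have h := M.transition_smooth a.1 b n
    rw [OpenPartialHomeomorph.trans_source] at h
    let e : VPts (M.ev ⊕ N.ev) (M.od ⊕ N.od) n →L[ℝ] VPts M.ev M.od n :=
      (ContinuousLinearMap.fst ℝ _ _).comp
        (VPts.prodEquiv M.ev M.od N.ev N.od n).symm.toContinuousLinearMap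
    refine ⟨h.1.comp e.contDiff.contDiffOn (fun v hv => ⟨hv.1.1, hv.2⟩), fun x hx => ?_⟩
    obtain ⟨D, hD, hDa⟩ := h.2 (e x) ⟨hx.1.1, hx.2⟩
    exact ⟨D.comp e, hD.comp x e.hasFDerivAt, fun a v => hDa a (e v)⟩

end SuperGeometry

namespace Tricat

section Bicat

variable {B : Type u} [Bicategory.{u, u} B] {C : Type u} [Bicategory.{u, u} C]
  {D : Type u} [Bicategory.{u, u} D]

/-- The pairing of two pseudofunctors. -/
def pair (F : D ⥤ᵖ B) (G : D ⥤ᵖ C) : D ⥤ᵖ B × C where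
  obj d := (F.obj d, G.obj d)
  map f := (F.map f, G.map f)
  map₂ η := (F.map₂ η, G.map₂ η)
  map₂_id f := Prod.ext (F.map₂_id f) (G.map₂_id f)
  map₂_comp η θ := Prod.ext (F.map₂_comp η θ) (G.map₂_comp η θ)
  mapId d := Iso.prod (F.mapId d) (G.mapId d)
  mapComp f g := Iso.prod (F.mapComp f g) (G.mapComp f g)
  map₂_whisker_left f _ _ η := Prod.ext (F.map₂_whisker_left f η) (G.map₂_whisker_left f η)
  map₂_whisker_right η f := Prod.ext (F.map₂_whisker_right η f) (G.map₂_whisker_right η f)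
  map₂_associator f g h := Prod.ext (F.map₂_associator f g h) (G.map₂_associator f g h)
  map₂_left_unitor f := Prod.ext (F.map₂_left_unitor f) (G.map₂_left_unitor f)
  map₂_right_unitor f := Prod.ext (F.map₂_right_unitor f) (G.map₂_right_unitor f)

/-- The first projection as a pseudofunctor. -/
def pr₁ (B C : Type u) [Bicategory.{u, u} B] [Bicategory.{u, u} C] : B × C ⥤ᵖ B :=
  (Bicategory.Prod.fst B C).toPseudofunctor

/-- The second projection as a pseudofunctor. -/
def pr₂ (B C : Type u) [Bicategory.{u, u} B] [Bicategory.{u, u} C] : B × C ⥤ᵖ C :=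
  (Bicategory.Prod.snd B C).toPseudofunctor

/-- The pseudofunctor `Y ↦ (b, Y)`. -/
def insL {B : Type u} [Bicategory.{u, u} B] (b : B) (C : Type u) [Bicategory.{u, u} C] :
    C ⥤ᵖ B × C :=
  (Bicategory.Prod.sectR b C).toPseudofunctor

/-- The pseudofunctor `X ↦ (X, c)`. -/
def insR (B : Type u) [Bicategory.{u, u} B] {C : Type u} [Bicategory.{u, u} C] (c : C) :
    B ⥤ᵖ B × C :=
  (Bicategory.Prod.sectL B c).toPseudofunctor

/-- Pasting of naturality squares: the naturality cell of a composite transformation. -/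
def sqComp {a b c a' b' c' : B} {p : a ⟶ b} {q : b ⟶ c} {p' : a' ⟶ b'} {q' : b' ⟶ c'}
    {u : a ⟶ a'} {v : b ⟶ b'} {w : c ⟶ c'} (σ : u ≫ p' ≅ p ≫ v) (τ : v ≫ q' ≅ q ≫ w) :
    u ≫ p' ≫ q' ≅ (p ≫ q) ≫ w :=
  (α_ u p' q').symm ≪≫ whiskerRightIso σ q' ≪≫ α_ p v q' ≪≫ whiskerLeftIso p τ ≪≫
    (α_ p q w).symm

/-- The naturality cell of an identity transformation. -/
def sqId {a a' : B} (u : a ⟶ a') : u ≫ 𝟙 a' ≅ 𝟙 a ≫ u := ρ_ u ≪≫ (λ_ u).symm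

/-- The mate of an isomorphism `p ≅ q` between equivalences: the isomorphism of inverses. -/
def mateIso {a b : B} {p q : a ⟶ b} {p' q' : b ⟶ a} (i : p ≫ p' ≅ 𝟙 a) (j : 𝟙 b ≅ q' ≫ q)
    (σ : p ≅ q) : p' ≅ q' :=
  (λ_ p').symm ≪≫ whiskerRightIso j p' ≪≫ α_ q' q p' ≪≫
    whiskerLeftIso q' (whiskerRightIso σ.symm p' ≪≫ i) ≪≫ ρ_ q'

/-- An equivalence can be cancelled on the right. -/
def cancelRight {a b c : B} {p q : a ⟶ b} {e : b ⟶ c} {e' : c ⟶ b} (i : e ≫ e' ≅ 𝟙 b)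
    (σ : p ≫ e ≅ q ≫ e) : p ≅ q :=
  (ρ_ p).symm ≪≫ whiskerLeftIso p i.symm ≪≫ (α_ _ _ _).symm ≪≫ whiskerRightIso σ e' ≪≫
    α_ _ _ _ ≪≫ whiskerLeftIso q i ≪≫ ρ_ q

/-- An equivalence can be cancelled on the left. -/
def cancelLeft {a b c : B} {p q : b ⟶ c} {e : a ⟶ b} {e' : b ⟶ a} (j : e' ≫ e ≅ 𝟙 b)
    (σ : e ≫ p ≅ e ≫ q) : p ≅ q :=
  (λ_ p).symm ≪≫ whiskerRightIso j.symm p ≪≫ α_ _ _ _ ≪≫ whiskerLeftIso e' σ ≪≫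
    (α_ _ _ _).symm ≪≫ whiskerRightIso j q ≪≫ λ_ q

/-- The component at an object of an isomorphism of transformations. -/
def appIso {F G : C ⥤ᵖ B} {θ η : F ⟶ G} (Γ : θ ≅ η) (c : C) : θ.app c ≅ η.app c where
  hom := Γ.hom.as.app c
  inv := Γ.inv.as.app c
  hom_inv_id := congrArg (fun m => m.as.app c) Γ.hom_inv_id
  inv_hom_id := congrArg (fun m => m.as.app c) Γ.inv_hom_id

end Bicat


/-! ### Tricategories -/

/-- A bicategory of 1-, 2- and 3-morphisms between any two objects, identities, and
composition at a 0-cell. -/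
structure TricatBase (Ob : Type u) where
  Hom : Ob → Ob → Type u
  [bicat : ∀ x y, Bicategory.{u, u} (Hom x y)]
  one : ∀ x, Hom x x
  comp : ∀ x y z, (Hom x y × Hom y z) ⥤ᵖ Hom x z

attribute [instance] TricatBase.bicat

namespace TricatBase

variable {Ob : Type u}

/-- The pseudofunctor `(f, g, h) ↦ (f · g) · h`. -/
def assocSrc (T : TricatBase Ob) (x y z w : Ob) :
    ((T.Hom x y × T.Hom y z) × T.Hom z w) ⥤ᵖ T.Hom x w :=
  (pair ((pr₁ (T.Hom x y × T.Hom y z) (T.Hom z w)).comp (T.comp x y z))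
    (pr₂ (T.Hom x y × T.Hom y z) (T.Hom z w))).comp (T.comp x z w)

/-- The pseudofunctor `(f, g, h) ↦ f · (g · h)`. -/
def assocTgt (T : TricatBase Ob) (x y z w : Ob) :
    ((T.Hom x y × T.Hom y z) × T.Hom z w) ⥤ᵖ T.Hom x w :=
  (pair ((pr₁ (T.Hom x y × T.Hom y z) (T.Hom z w)).comp (pr₁ (T.Hom x y) (T.Hom y z)))
    ((pair ((pr₁ (T.Hom x y × T.Hom y z) (T.Hom z w)).comp (pr₂ (T.Hom x y) (T.Hom y z)))
      (pr₂ (T.Hom x y × T.Hom y z) (T.Hom z w))).comp (T.comp y z w))).comp (T.comp x y w)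

/-- The pseudofunctor `f ↦ 1 · f`. -/
def leftSrc (T : TricatBase Ob) (x y : Ob) : T.Hom x y ⥤ᵖ T.Hom x y :=
  (insL (T.one x) (T.Hom x y)).comp (T.comp x x y)

/-- The pseudofunctor `f ↦ f · 1`. -/
def rightSrc (T : TricatBase Ob) (x y : Ob) : T.Hom x y ⥤ᵖ T.Hom x y :=
  (insR (T.Hom x y) (T.one y)).comp (T.comp x y y)

variable {T : TricatBase Ob} {x y z : Ob}

/-- Composition of 1-morphisms at a 0-cell. -/
abbrev o (f : T.Hom x y) (g : T.Hom y z) : T.Hom x z := (T.comp x y z).obj (f, g)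

/-- Composition of 2-morphisms at a 0-cell. -/
abbrev o₂ {f f' : T.Hom x y} {g g' : T.Hom y z} (α : f ⟶ f') (β : g ⟶ g') : o f g ⟶ o f' g' :=
  (T.comp x y z).map (X := (f, g)) (Y := (f', g')) (α, β)

/-- Composition of 3-morphisms at a 0-cell. -/
abbrev o₃ {f f' : T.Hom x y} {g g' : T.Hom y z} {α α' : f ⟶ f'} {β β' : g ⟶ g'} (Γ : α ⟶ α')
    (Γ' : β ⟶ β') : o₂ α β ⟶ o₂ α' β' :=
  (T.comp x y z).map₂ (a := (f, g)) (b := (f', g')) (f := (α, β)) (g := (α', β')) (Γ, Γ')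

/-- Composition of invertible 3-morphisms at a 0-cell. -/
abbrev oIso {f f' : T.Hom x y} {g g' : T.Hom y z} {α α' : f ⟶ f'} {β β' : g ⟶ g'} (Γ : α ≅ α')
    (Γ' : β ≅ β') : o₂ α β ≅ o₂ α' β' :=
  (T.comp x y z).map₂Iso (a := (f, g)) (b := (f', g')) (f := (α, β)) (g := (α', β'))
    (Iso.prod Γ Γ')

/-- The constraint of composition at a 0-cell for composites at a 1-cell. -/
abbrev oComp {f f' f'' : T.Hom x y} {g g' g'' : T.Hom y z} (α : f ⟶ f') (α' : f' ⟶ f'')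
    (β : g ⟶ g') (β' : g' ⟶ g'') : o₂ (α ≫ α') (β ≫ β') ≅ o₂ α β ≫ o₂ α' β' :=
  (T.comp x y z).mapComp (a := (f, g)) (b := (f', g')) (c := (f'', g'')) (α, β) (α', β')

/-- The constraint of composition at a 0-cell for identities. -/
abbrev oId (f : T.Hom x y) (g : T.Hom y z) : o₂ (𝟙 f) (𝟙 g) ≅ 𝟙 (o f g) :=
  (T.comp x y z).mapId (f, g)

/-- `(α α') · 1 ≅ (α · 1) (α' · 1)` -/
def distR {f f' f'' : T.Hom x y} (α : f ⟶ f') (α' : f' ⟶ f'') (g : T.Hom y z) :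
    o₂ (α ≫ α') (𝟙 g) ≅ o₂ α (𝟙 g) ≫ o₂ α' (𝟙 g) :=
  oIso (Iso.refl _) (λ_ (𝟙 g)).symm ≪≫ oComp α α' (𝟙 g) (𝟙 g)

/-- `1 · (β β') ≅ (1 · β) (1 · β')` -/
def distL (f : T.Hom x y) {g g' g'' : T.Hom y z} (β : g ⟶ g') (β' : g' ⟶ g'') :
    o₂ (𝟙 f) (β ≫ β') ≅ o₂ (𝟙 f) β ≫ o₂ (𝟙 f) β' :=
  oIso (λ_ (𝟙 f)).symm (Iso.refl _) ≪≫ oComp (𝟙 f) (𝟙 f) β β'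

/-- The composite at a 0-cell of two naturality cells. -/
def sqO {f₁ f₂ f₃ f₄ : T.Hom x y} {g₁ g₂ g₃ g₄ : T.Hom y z} {p : f₁ ⟶ f₂} {p' : f₃ ⟶ f₄}
    {u : f₁ ⟶ f₃} {v : f₂ ⟶ f₄} {q : g₁ ⟶ g₂} {q' : g₃ ⟶ g₄} {s : g₁ ⟶ g₃} {t : g₂ ⟶ g₄}
    (σ : u ≫ p' ≅ p ≫ v) (τ : s ≫ q' ≅ q ≫ t) : o₂ u s ≫ o₂ p' q' ≅ o₂ p q ≫ o₂ v t :=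
  (oComp u p' s q').symm ≪≫ oIso σ τ ≪≫ oComp p v q t

end TricatBase

open TricatBase

/-- A `TricatBase` with adjoint equivalences, the associator and the left and right unitors. -/
structure TricatUnits (Ob : Type u) extends TricatBase Ob where
  assoc : ∀ x y z w, toTricatBase.assocSrc x y z w ≌ toTricatBase.assocTgt x y z w
  left : ∀ x y, toTricatBase.leftSrc x y ≌ Pseudofunctor.id (Hom x y)
  right : ∀ x y, toTricatBase.rightSrc x y ≌ Pseudofunctor.id (Hom x y)

namespace TricatUnits

variable {Ob : Type u} (T : TricatUnits Ob) {x y z w : Ob}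

/-- The associator `(f · g) · h ⇒ f · (g · h)`. -/
def a (f : T.Hom x y) (g : T.Hom y z) (h : T.Hom z w) : o (o f g) h ⟶ o f (o g h) :=
  (T.assoc x y z w).hom.app ((f, g), h)

/-- The chosen inverse of the associator. -/
def a' (f : T.Hom x y) (g : T.Hom y z) (h : T.Hom z w) : o f (o g h) ⟶ o (o f g) h :=
  (T.assoc x y z w).inv.app ((f, g), h)

/-- The unit of the associator. -/
def aUnit (f : T.Hom x y) (g : T.Hom y z) (h : T.Hom z w) : 𝟙 _ ≅ T.a f g h ≫ T.a' f g h :=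
  appIso (T.assoc x y z w).unit ((f, g), h)

/-- The counit of the associator. -/
def aCounit (f : T.Hom x y) (g : T.Hom y z) (h : T.Hom z w) : T.a' f g h ≫ T.a f g h ≅ 𝟙 _ :=
  appIso (T.assoc x y z w).counit ((f, g), h)

/-- The naturality cell of the associator. -/
def aNat {f f' : T.Hom x y} {g g' : T.Hom y z} {h h' : T.Hom z w} (α : f ⟶ f') (β : g ⟶ g')
    (γ : h ⟶ h') : o₂ (o₂ α β) γ ≫ T.a f' g' h' ≅ T.a f g h ≫ o₂ α (o₂ β γ) :=
  (T.assoc x y z w).hom.naturality (a := ((f, g), h)) (b := ((f', g'), h')) ((α, β), γ)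

/-- The naturality cell of the inverse of the associator. -/
def aNat' {f f' : T.Hom x y} {g g' : T.Hom y z} {h h' : T.Hom z w} (α : f ⟶ f') (β : g ⟶ g')
    (γ : h ⟶ h') : o₂ α (o₂ β γ) ≫ T.a' f' g' h' ≅ T.a' f g h ≫ o₂ (o₂ α β) γ :=
  (T.assoc x y z w).inv.naturality (a := ((f, g), h)) (b := ((f', g'), h')) ((α, β), γ)

/-- The left unitor `1 · f ⇒ f`. -/
def l (f : T.Hom x y) : o (T.one x) f ⟶ f := (T.left x y).hom.app f

/-- The chosen inverse of the left unitor. -/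
def l' (f : T.Hom x y) : f ⟶ o (T.one x) f := (T.left x y).inv.app f

/-- The unit of the left unitor. -/
def lUnit (f : T.Hom x y) : 𝟙 _ ≅ T.l f ≫ T.l' f := appIso (T.left x y).unit f

/-- The counit of the left unitor. -/
def lCounit (f : T.Hom x y) : T.l' f ≫ T.l f ≅ 𝟙 _ := appIso (T.left x y).counit f

/-- The naturality cell of the left unitor. -/
def lNat {f f' : T.Hom x y} (α : f ⟶ f') : o₂ (𝟙 (T.one x)) α ≫ T.l f' ≅ T.l f ≫ α :=
  (T.left x y).hom.naturality α

/-- The naturality cell of the inverse of the left unitor. -/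
def lNat' {f f' : T.Hom x y} (α : f ⟶ f') : α ≫ T.l' f' ≅ T.l' f ≫ o₂ (𝟙 (T.one x)) α :=
  (T.left x y).inv.naturality α

/-- The right unitor `f · 1 ⇒ f`. -/
def r (f : T.Hom x y) : o f (T.one y) ⟶ f := (T.right x y).hom.app f

/-- The chosen inverse of the right unitor. -/
def r' (f : T.Hom x y) : f ⟶ o f (T.one y) := (T.right x y).inv.app f

/-- The unit of the right unitor. -/
def rUnit (f : T.Hom x y) : 𝟙 _ ≅ T.r f ≫ T.r' f := appIso (T.right x y).unit f

/-- The counit of the right unitor. -/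
def rCounit (f : T.Hom x y) : T.r' f ≫ T.r f ≅ 𝟙 _ := appIso (T.right x y).counit f

/-- The naturality cell of the right unitor. -/
def rNat {f f' : T.Hom x y} (α : f ⟶ f') : o₂ α (𝟙 (T.one y)) ≫ T.r f' ≅ T.r f ≫ α :=
  (T.right x y).hom.naturality α

/-- The naturality cell of the inverse of the right unitor. -/
def rNat' {f f' : T.Hom x y} (α : f ⟶ f') : α ≫ T.r' f' ≅ T.r' f ≫ o₂ α (𝟙 (T.one y)) :=
  (T.right x y).inv.naturality α

end TricatUnits

/-- A `TricatUnits` with the invertible 3-morphisms underlying the pentagonator and the left, middle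
and right triangulators. -/
structure TricatCells (Ob : Type u) extends TricatUnits Ob where
  pi : ∀ {x y z w v : Ob} (f : Hom x y) (g : Hom y z) (h : Hom z w) (k : Hom w v),
    o₂ (toTricatUnits.a f g h) (𝟙 k) ≫ toTricatUnits.a f (o g h) k ≫
        o₂ (𝟙 f) (toTricatUnits.a g h k) ≅
      toTricatUnits.a (o f g) h k ≫ toTricatUnits.a f g (o h k)
  lam : ∀ {x y z : Ob} (f : Hom x y) (g : Hom y z),
    o₂ (toTricatUnits.l f) (𝟙 g) ≅ toTricatUnits.a (one x) f g ≫ toTricatUnits.l (o f g)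
  mu : ∀ {x y z : Ob} (f : Hom x y) (g : Hom y z),
    o₂ (toTricatUnits.r f) (𝟙 g) ≅
      toTricatUnits.a f (one y) g ≫ o₂ (𝟙 f) (toTricatUnits.l g)
  rho : ∀ {x y z : Ob} (f : Hom x y) (g : Hom y z),
    toTricatUnits.r (o f g) ≅
      toTricatUnits.a f g (one z) ≫ o₂ (𝟙 f) (toTricatUnits.r g)

namespace TricatCells

variable {Ob : Type u} (T : TricatCells Ob) {x y z w v : Ob}

/-- The 3-morphism `π · 1`. -/
def piR (f : T.Hom x y) (g : T.Hom y z) (h : T.Hom z w) (k : T.Hom w v) {t : Ob} (p : T.Hom v t) :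
    o₂ (o₂ (T.a f g h) (𝟙 k)) (𝟙 p) ≫ o₂ (T.a f (o g h) k) (𝟙 p) ≫
        o₂ (o₂ (𝟙 f) (T.a g h k)) (𝟙 p) ≅
      o₂ (T.a (o f g) h k) (𝟙 p) ≫ o₂ (T.a f g (o h k)) (𝟙 p) :=
  whiskerLeftIso _ (distR _ _ p).symm ≪≫ (distR _ _ p).symm ≪≫
    oIso (T.pi f g h k) (Iso.refl (𝟙 p)) ≪≫ distR _ _ p

/-- The 3-morphism `1 · π`. -/
def piL {t : Ob} (e : T.Hom t x) (f : T.Hom x y) (g : T.Hom y z) (h : T.Hom z w) (k : T.Hom w v) :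
    o₂ (𝟙 e) (o₂ (T.a f g h) (𝟙 k)) ≫ o₂ (𝟙 e) (T.a f (o g h) k) ≫
        o₂ (𝟙 e) (o₂ (𝟙 f) (T.a g h k)) ≅
      o₂ (𝟙 e) (T.a (o f g) h k) ≫ o₂ (𝟙 e) (T.a f g (o h k)) :=
  whiskerLeftIso _ (distL e _ _).symm ≪≫ (distL e _ _).symm ≪≫
    oIso (Iso.refl (𝟙 e)) (T.pi f g h k) ≪≫ distL e _ _

/-- The first pasting of the pentagonator identity. -/
def pentFst {t : Ob} (f : T.Hom x y) (g : T.Hom y z) (h : T.Hom z w) (k : T.Hom w v)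
    (p : T.Hom v t) :
    o₂ (o₂ (T.a f g h) (𝟙 k)) (𝟙 p) ≫ o₂ (T.a f (o g h) k) (𝟙 p) ≫
        o₂ (o₂ (𝟙 f) (T.a g h k)) (𝟙 p) ≫ T.a f (o g (o h k)) p ≫
        o₂ (𝟙 f) (T.a g (o h k) p) ≫ o₂ (𝟙 f) (o₂ (𝟙 g) (T.a h k p)) ⟶
      T.a (o (o f g) h) k p ≫ T.a (o f g) h (o k p) ≫ T.a f g (o h (o k p)) :=
  𝟙 _ ⊗≫ (T.piR f g h k p).hom ▷
      (T.a f (o g (o h k)) p ≫ o₂ (𝟙 f) (T.a g (o h k) p) ≫ o₂ (𝟙 f) (o₂ (𝟙 g) (T.a h k p))) ⊗≫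
    o₂ (T.a (o f g) h k) (𝟙 p) ◁ (T.pi f g (o h k) p).hom ▷ o₂ (𝟙 f) (o₂ (𝟙 g) (T.a h k p)) ⊗≫
    (o₂ (T.a (o f g) h k) (𝟙 p) ≫ T.a (o f g) (o h k) p) ◁
      (T.aNat (𝟙 f) (𝟙 g) (T.a h k p)).inv ⊗≫
    (o₂ (T.a (o f g) h k) (𝟙 p) ≫ T.a (o f g) (o h k) p) ◁
      (oIso (oId f g) (Iso.refl (T.a h k p))).hom ▷ T.a f g (o h (o k p)) ⊗≫
    (T.pi (o f g) h k p).hom ▷ T.a f g (o h (o k p)) ⊗≫ 𝟙 _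

/-- The second pasting of the pentagonator identity. -/
def pentSnd {t : Ob} (f : T.Hom x y) (g : T.Hom y z) (h : T.Hom z w) (k : T.Hom w v)
    (p : T.Hom v t) :
    o₂ (o₂ (T.a f g h) (𝟙 k)) (𝟙 p) ≫ o₂ (T.a f (o g h) k) (𝟙 p) ≫
        o₂ (o₂ (𝟙 f) (T.a g h k)) (𝟙 p) ≫ T.a f (o g (o h k)) p ≫
        o₂ (𝟙 f) (T.a g (o h k) p) ≫ o₂ (𝟙 f) (o₂ (𝟙 g) (T.a h k p)) ⟶
      T.a (o (o f g) h) k p ≫ T.a (o f g) h (o k p) ≫ T.a f g (o h (o k p)) :=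
  𝟙 _ ⊗≫ (o₂ (o₂ (T.a f g h) (𝟙 k)) (𝟙 p) ≫ o₂ (T.a f (o g h) k) (𝟙 p)) ◁
      (T.aNat (𝟙 f) (T.a g h k) (𝟙 p)).hom ▷
      (o₂ (𝟙 f) (T.a g (o h k) p) ≫ o₂ (𝟙 f) (o₂ (𝟙 g) (T.a h k p))) ⊗≫
    (o₂ (o₂ (T.a f g h) (𝟙 k)) (𝟙 p) ≫ o₂ (T.a f (o g h) k) (𝟙 p) ≫ T.a f (o (o g h) k) p) ◁
      (T.piL f g h k p).hom ⊗≫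
    o₂ (o₂ (T.a f g h) (𝟙 k)) (𝟙 p) ◁ (T.pi f (o g h) k p).hom ▷
      o₂ (𝟙 f) (T.a g h (o k p)) ⊗≫
    (T.aNat (T.a f g h) (𝟙 k) (𝟙 p)).hom ▷
      (T.a f (o g h) (o k p) ≫ o₂ (𝟙 f) (T.a g h (o k p))) ⊗≫
    T.a (o (o f g) h) k p ◁ (oIso (Iso.refl (T.a f g h)) (oId k p)).hom ▷
      (T.a f (o g h) (o k p) ≫ o₂ (𝟙 f) (T.a g h (o k p))) ⊗≫
    T.a (o (o f g) h) k p ◁ (T.pi f g h (o k p)).hom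

/-- The first pasting of the left normalization axiom. -/
def leftNormFst (f : T.Hom x y) (g : T.Hom y z) (h : T.Hom z w) :
    o₂ (o₂ (T.r f) (𝟙 g)) (𝟙 h) ≫ T.a f g h ⟶
      T.a (o f (T.one y)) g h ≫ T.a f (T.one y) (o g h) ≫ o₂ (𝟙 f) (T.l (o g h)) :=
  (oIso (T.mu f g) (Iso.refl (𝟙 h)) ≪≫ distR _ _ h).hom ▷ T.a f g h ⊗≫
    o₂ (T.a f (T.one y) g) (𝟙 h) ◁ (T.aNat (𝟙 f) (T.l g) (𝟙 h)).hom ⊗≫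
    (o₂ (T.a f (T.one y) g) (𝟙 h) ≫ T.a f (o (T.one y) g) h) ◁
      (oIso (Iso.refl (𝟙 f)) (T.lam g h) ≪≫ distL f _ _).hom ⊗≫
    (T.pi f (T.one y) g h).hom ▷ o₂ (𝟙 f) (T.l (o g h)) ⊗≫ 𝟙 _

/-- The second pasting of the left normalization axiom. -/
def leftNormSnd (f : T.Hom x y) (g : T.Hom y z) (h : T.Hom z w) :
    o₂ (o₂ (T.r f) (𝟙 g)) (𝟙 h) ≫ T.a f g h ⟶
      T.a (o f (T.one y)) g h ≫ T.a f (T.one y) (o g h) ≫ o₂ (𝟙 f) (T.l (o g h)) :=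
  (T.aNat (T.r f) (𝟙 g) (𝟙 h)).hom ≫
    T.a (o f (T.one y)) g h ◁
      (oIso (Iso.refl (T.r f)) (oId g h) ≪≫ T.mu f (o g h)).hom

/-- The first pasting of the right normalization axiom. -/
def rightNormFst (f : T.Hom x y) (g : T.Hom y z) (h : T.Hom z w) :
    o₂ (T.r (o f g)) (𝟙 h) ≫ T.a f g h ⟶
      T.a (o f g) (T.one z) h ≫ T.a f g (o (T.one z) h) ≫ o₂ (𝟙 f) (o₂ (𝟙 g) (T.l h)) :=
  (oIso (T.rho f g) (Iso.refl (𝟙 h)) ≪≫ distR _ _ h).hom ▷ T.a f g h ⊗≫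
    o₂ (T.a f g (T.one z)) (𝟙 h) ◁ (T.aNat (𝟙 f) (T.r g) (𝟙 h)).hom ⊗≫
    (o₂ (T.a f g (T.one z)) (𝟙 h) ≫ T.a f (o g (T.one z)) h) ◁
      (oIso (Iso.refl (𝟙 f)) (T.mu g h) ≪≫ distL f _ _).hom ⊗≫
    (T.pi f g (T.one z) h).hom ▷ o₂ (𝟙 f) (o₂ (𝟙 g) (T.l h)) ⊗≫ 𝟙 _

/-- The second pasting of the right normalization axiom. -/
def rightNormSnd (f : T.Hom x y) (g : T.Hom y z) (h : T.Hom z w) :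
    o₂ (T.r (o f g)) (𝟙 h) ≫ T.a f g h ⟶
      T.a (o f g) (T.one z) h ≫ T.a f g (o (T.one z) h) ≫ o₂ (𝟙 f) (o₂ (𝟙 g) (T.l h)) :=
  (T.mu (o f g) h).hom ▷ T.a f g h ⊗≫
    T.a (o f g) (T.one z) h ◁
      (oIso (oId f g).symm (Iso.refl (T.l h))).hom ▷ T.a f g h ⊗≫
    T.a (o f g) (T.one z) h ◁ (T.aNat (𝟙 f) (𝟙 g) (T.l h)).hom

end TricatCells

/-- A tricategory with set of objects `Ob`: the pentagonator and the triangulators are modifications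
and satisfy the pentagonator identity and the two normalization axioms. -/
structure Tricategory (Ob : Type u) extends TricatCells Ob where
  pi_mod : ∀ {x y z w v : Ob} {f f' : Hom x y} {g g' : Hom y z} {h h' : Hom z w} {k k' : Hom w v}
    (α : f ⟶ f') (β : g ⟶ g') (γ : h ⟶ h') (δ : k ⟶ k'),
    o₂ (o₂ (o₂ α β) γ) δ ◁ (pi f' g' h' k').hom ≫
        (sqComp (toTricatUnits.aNat (o₂ α β) γ δ) (toTricatUnits.aNat α β (o₂ γ δ))).hom =
      (sqComp (sqO (toTricatUnits.aNat α β γ) (sqId δ))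
        (sqComp (toTricatUnits.aNat α (o₂ β γ) δ)
          (sqO (sqId α) (toTricatUnits.aNat β γ δ)))).hom ≫
        (pi f g h k).hom ▷ o₂ α (o₂ β (o₂ γ δ))
  lam_mod : ∀ {x y z : Ob} {f f' : Hom x y} {g g' : Hom y z} (α : f ⟶ f') (β : g ⟶ g'),
    o₂ (o₂ (𝟙 (one x)) α) β ◁ (lam f' g').hom ≫
        (sqComp (toTricatUnits.aNat (𝟙 (one x)) α β) (toTricatUnits.lNat (o₂ α β))).hom =
      (sqO (toTricatUnits.lNat α) (sqId β)).hom ≫ (lam f g).hom ▷ o₂ α β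
  mu_mod : ∀ {x y z : Ob} {f f' : Hom x y} {g g' : Hom y z} (α : f ⟶ f') (β : g ⟶ g'),
    o₂ (o₂ α (𝟙 (one y))) β ◁ (mu f' g').hom ≫
        (sqComp (toTricatUnits.aNat α (𝟙 (one y)) β)
          (sqO (sqId α) (toTricatUnits.lNat β))).hom =
      (sqO (toTricatUnits.rNat α) (sqId β)).hom ≫ (mu f g).hom ▷ o₂ α β
  rho_mod : ∀ {x y z : Ob} {f f' : Hom x y} {g g' : Hom y z} (α : f ⟶ f') (β : g ⟶ g'),
    o₂ (o₂ α β) (𝟙 (one z)) ◁ (rho f' g').hom ≫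
        (sqComp (toTricatUnits.aNat α β (𝟙 (one z)))
          (sqO (sqId α) (toTricatUnits.rNat β))).hom =
      (toTricatUnits.rNat (o₂ α β)).hom ≫ (rho f g).hom ▷ o₂ α β
  /-- the pentagonator identity -/
  pentagonator : ∀ {x y z w v t : Ob} (f : Hom x y) (g : Hom y z) (h : Hom z w) (k : Hom w v)
    (p : Hom v t), toTricatCells.pentFst f g h k p = toTricatCells.pentSnd f g h k p
  left_norm : ∀ {x y z w : Ob} (f : Hom x y) (g : Hom y z) (h : Hom z w),
    toTricatCells.leftNormFst f g h = toTricatCells.leftNormSnd f g h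
  right_norm : ∀ {x y z w : Ob} (f : Hom x y) (g : Hom y z) (h : Hom z w),
    toTricatCells.rightNormFst f g h = toTricatCells.rightNormSnd f g h


/-! ### Weak inverses in a tricategory -/

namespace TricatCells

variable {Ob : Type u} (T : TricatCells Ob) {x y z w v : Ob}

/-- The canonical isomorphism between the left and the right unitor of an identity. -/
def lrOne (x : Ob) : T.l (T.one x) ≅ T.r (T.one x) :=
  cancelLeft (T.rCounit (o (T.one x) (T.one x)))
    ((T.rNat (T.l (T.one x))).symm ≪≫
      whiskerRightIso
        (T.lam (T.one x) (T.one x) ≪≫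
          whiskerLeftIso _ (cancelRight (T.lUnit (T.one x)).symm (T.lNat (T.l (T.one x)))).symm ≪≫
          (T.mu (T.one x) (T.one x)).symm)
        (T.r (T.one x)) ≪≫
      T.rNat (T.r (T.one x)))

/-- The canonical isomorphism between the inverses of the unitors of an identity. -/
def lrOne' (x : Ob) : T.l' (T.one x) ≅ T.r' (T.one x) :=
  mateIso (T.lUnit (T.one x)).symm (T.rCounit (T.one x)).symm (T.lrOne x)

/-- The mate `l⁻¹ · 1 ≅ l⁻¹ a⁻¹` of the inverse of the left triangulator. -/
def lam₁ (f : T.Hom x y) (g : T.Hom y z) :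
    o₂ (T.l' f) (𝟙 g) ≅ T.l' (o f g) ≫ T.a' (T.one x) f g :=
  mateIso
    ((distR (T.l f) (T.l' f) g).symm ≪≫ oIso (T.lUnit f).symm (Iso.refl (𝟙 g)) ≪≫ oId _ g)
    ((T.lCounit (o f g)).symm ≪≫
      whiskerLeftIso (T.l' (o f g)) ((λ_ _).symm ≪≫
        whiskerRightIso (T.aCounit (T.one x) f g).symm (T.l (o f g)) ≪≫ α_ _ _ _) ≪≫
      (α_ _ _ _).symm)
    (T.lam f g)

/-- The mate `π₁ : a⁻¹ (a · 1) a ⇛ a (1 · a⁻¹)` of the pentagonator. -/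
def pi₁ (f : T.Hom x y) (g : T.Hom y z) (h : T.Hom z w) (k : T.Hom w v) :
    T.a' (o f g) h k ≫ o₂ (T.a f g h) (𝟙 k) ≫ T.a f (o g h) k ⟶
      T.a f g (o h k) ≫ o₂ (𝟙 f) (T.a' g h k) :=
  𝟙 _ ⊗≫ (T.a' (o f g) h k ≫ o₂ (T.a f g h) (𝟙 k) ≫ T.a f (o g h) k) ◁
      ((oId f (o (o g h) k)).symm ≪≫ oIso (Iso.refl (𝟙 f)) (T.aUnit g h k) ≪≫ distL f _ _).hom ⊗≫
    T.a' (o f g) h k ◁ (T.pi f g h k).hom ▷ o₂ (𝟙 f) (T.a' g h k) ⊗≫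
    (T.aCounit (o f g) h k).hom ▷ (T.a f g (o h k) ≫ o₂ (𝟙 f) (T.a' g h k)) ⊗≫ 𝟙 _

/-- The mate `ρ₁ : r⁻¹ a ⇛ 1 · r⁻¹` of the right triangulator. -/
def rho₁ (f : T.Hom x y) (g : T.Hom y z) :
    T.r' (o f g) ≫ T.a f g (T.one z) ⟶ o₂ (𝟙 f) (T.r' g) :=
  𝟙 _ ⊗≫ (T.r' (o f g) ≫ T.a f g (T.one z)) ◁
      ((oId f (o g (T.one z))).symm ≪≫ oIso (Iso.refl (𝟙 f)) (T.rUnit g) ≪≫ distL f _ _).hom ⊗≫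
    T.r' (o f g) ◁ (T.rho f g).inv ▷ o₂ (𝟙 f) (T.r' g) ⊗≫
    (T.rCounit (o f g)).hom ▷ o₂ (𝟙 f) (T.r' g) ⊗≫ 𝟙 _

section Swallowtail

variable (f : T.Hom x y) (f' : T.Hom y x) (e : o f' f ⟶ T.one y) (n : T.one x ⟶ o f f')

/-- The composite `f ⇒ 1 f ⇒ (f f⁻¹) f ⇒ f (f⁻¹ f) ⇒ f 1 ⇒ f`. -/
abbrev zigzag : f ⟶ f :=
  T.l' f ≫ o₂ n (𝟙 f) ≫ T.a f f' f ≫ o₂ (𝟙 f) e ≫ T.r f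

/-- The composite `f⁻¹ ⇒ f⁻¹ 1 ⇒ f⁻¹ (f f⁻¹) ⇒ (f⁻¹ f) f⁻¹ ⇒ 1 f⁻¹ ⇒ f⁻¹`. -/
abbrev zagzig : f' ⟶ f' :=
  T.r' f' ≫ o₂ (𝟙 f') n ≫ T.a' f' f f' ≫ o₂ e (𝟙 f') ≫ T.l f'

/-- Interchange of the two factors of `η · η`. -/
def etaInterchange : o₂ (𝟙 (T.one x)) n ≫ o₂ n (o₂ (𝟙 f) (𝟙 f')) ≅
    o₂ n (𝟙 (T.one x)) ≫ o₂ (o₂ (𝟙 f) (𝟙 f')) n :=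
  (oComp (𝟙 (T.one x)) n n (o₂ (𝟙 f) (𝟙 f'))).symm ≪≫
    oIso (λ_ n) (whiskerLeftIso n (oId f f') ≪≫ ρ_ n) ≪≫
    oIso (whiskerLeftIso n (oId f f') ≪≫ ρ_ n).symm (λ_ n).symm ≪≫
    oComp n (o₂ (𝟙 f) (𝟙 f')) (𝟙 (T.one x)) n

/-- The pasting in the swallowtail identity. -/
def swallowtail (Φ : 𝟙 f ≅ T.zigzag f f' e n) (Θ : 𝟙 f' ≅ T.zagzig f f' e n) :
    n ≫ o₂ (𝟙 f) (𝟙 f') ⟶ n ≫ o₂ (𝟙 f) (𝟙 f') :=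
  n ◁ (oIso Φ (Iso.refl (𝟙 f')) ≪≫ distR _ _ f' ≪≫ whiskerLeftIso _ (distR _ _ f' ≪≫
      whiskerLeftIso _ (distR _ _ f' ≪≫ whiskerLeftIso _ (distR _ _ f')))).hom ⊗≫
    n ◁ (T.lam₁ f f').hom ▷ (o₂ (o₂ n (𝟙 f)) (𝟙 f') ≫ o₂ (T.a f f' f) (𝟙 f') ≫
      o₂ (o₂ (𝟙 f) e) (𝟙 f') ≫ o₂ (T.r f) (𝟙 f')) ⊗≫
    (n ≫ T.l' (o f f')) ◁ (T.aNat' n (𝟙 f) (𝟙 f')).inv ▷ (o₂ (T.a f f' f) (𝟙 f') ≫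
      o₂ (o₂ (𝟙 f) e) (𝟙 f') ≫ o₂ (T.r f) (𝟙 f')) ⊗≫
    (T.lNat' n).hom ▷ (o₂ n (o₂ (𝟙 f) (𝟙 f')) ≫ T.a' (o f f') f f' ≫ o₂ (T.a f f' f) (𝟙 f') ≫
      o₂ (o₂ (𝟙 f) e) (𝟙 f') ≫ o₂ (T.r f) (𝟙 f')) ⊗≫
    (T.lrOne' x).hom ▷ (o₂ (𝟙 (T.one x)) n ≫ o₂ n (o₂ (𝟙 f) (𝟙 f')) ≫ T.a' (o f f') f f' ≫
      o₂ (T.a f f' f) (𝟙 f') ≫ o₂ (o₂ (𝟙 f) e) (𝟙 f') ≫ o₂ (T.r f) (𝟙 f')) ⊗≫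
    T.r' (T.one x) ◁ (T.etaInterchange f f' n).hom ▷ (T.a' (o f f') f f' ≫
      o₂ (T.a f f' f) (𝟙 f') ≫ o₂ (o₂ (𝟙 f) e) (𝟙 f') ≫ o₂ (T.r f) (𝟙 f')) ⊗≫
    (T.r' (T.one x) ≫ o₂ n (𝟙 (T.one x)) ≫ o₂ (o₂ (𝟙 f) (𝟙 f')) n ≫ T.a' (o f f') f f' ≫
      o₂ (T.a f f' f) (𝟙 f') ≫ o₂ (o₂ (𝟙 f) e) (𝟙 f')) ◁ (T.mu f f').hom ⊗≫
    (T.r' (T.one x) ≫ o₂ n (𝟙 (T.one x)) ≫ o₂ (o₂ (𝟙 f) (𝟙 f')) n ≫ T.a' (o f f') f f' ≫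
      o₂ (T.a f f' f) (𝟙 f')) ◁ (T.aNat (𝟙 f) e (𝟙 f')).hom ▷ o₂ (𝟙 f) (T.l f') ⊗≫
    (T.r' (T.one x) ≫ o₂ n (𝟙 (T.one x)) ≫ o₂ (o₂ (𝟙 f) (𝟙 f')) n) ◁ T.pi₁ f f' f f' ▷
      (o₂ (𝟙 f) (o₂ e (𝟙 f')) ≫ o₂ (𝟙 f) (T.l f')) ⊗≫
    (T.r' (T.one x) ≫ o₂ n (𝟙 (T.one x))) ◁ (T.aNat (𝟙 f) (𝟙 f') n).hom ▷
      (o₂ (𝟙 f) (T.a' f' f f') ≫ o₂ (𝟙 f) (o₂ e (𝟙 f')) ≫ o₂ (𝟙 f) (T.l f')) ⊗≫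
    (T.rNat' n).inv ▷ (T.a f f' (T.one x) ≫ o₂ (𝟙 f) (o₂ (𝟙 f') n) ≫ o₂ (𝟙 f) (T.a' f' f f') ≫
      o₂ (𝟙 f) (o₂ e (𝟙 f')) ≫ o₂ (𝟙 f) (T.l f')) ⊗≫
    n ◁ T.rho₁ f f' ▷ (o₂ (𝟙 f) (o₂ (𝟙 f') n) ≫ o₂ (𝟙 f) (T.a' f' f f') ≫
      o₂ (𝟙 f) (o₂ e (𝟙 f')) ≫ o₂ (𝟙 f) (T.l f')) ⊗≫
    n ◁ (oIso (Iso.refl (𝟙 f)) Θ ≪≫ distL f _ _ ≪≫ whiskerLeftIso _ (distL f _ _ ≪≫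
      whiskerLeftIso _ (distL f _ _ ≪≫ whiskerLeftIso _ (distL f _ _)))).inv

end Swallowtail

end TricatCells

/-- Choices of (weak) inverses of all 3-morphisms, 2-morphisms and morphisms of a tricategory:
inverses of 3-morphisms, adjoint equivalences for 2-morphisms, and biadjoint biequivalences for
morphisms. -/
structure TricatInverses {Ob : Type u} (T : Tricategory Ob) where
  inv₃ : ∀ {x y : Ob} {f g : T.Hom x y} {α β : f ⟶ g}, (α ⟶ β) → (β ⟶ α)
  comp_inv₃ : ∀ {x y : Ob} {f g : T.Hom x y} {α β : f ⟶ g} (Γ : α ⟶ β), Γ ≫ inv₃ Γ = 𝟙 α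
  inv₃_comp : ∀ {x y : Ob} {f g : T.Hom x y} {α β : f ⟶ g} (Γ : α ⟶ β), inv₃ Γ ≫ Γ = 𝟙 β
  inv₂ : ∀ {x y : Ob} {f g : T.Hom x y}, (f ⟶ g) → (g ⟶ f)
  counit₂ : ∀ {x y : Ob} {f g : T.Hom x y} (α : f ⟶ g), inv₂ α ≫ α ≅ 𝟙 g
  unit₂ : ∀ {x y : Ob} {f g : T.Hom x y} (α : f ⟶ g), 𝟙 f ≅ α ≫ inv₂ α
  left_zigzag₂ : ∀ {x y : Ob} {f g : T.Hom x y} (α : f ⟶ g),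
    leftZigzag (unit₂ α).hom (counit₂ α).hom = (λ_ α).hom ≫ (ρ_ α).inv
  right_zigzag₂ : ∀ {x y : Ob} {f g : T.Hom x y} (α : f ⟶ g),
    rightZigzag (unit₂ α).hom (counit₂ α).hom = (ρ_ (inv₂ α)).hom ≫ (λ_ (inv₂ α)).inv
  inv₁ : ∀ {x y : Ob}, T.Hom x y → T.Hom y x
  eps : ∀ {x y : Ob} (f : T.Hom x y), o (inv₁ f) f ≌ T.one y
  eta : ∀ {x y : Ob} (f : T.Hom x y), T.one x ≌ o f (inv₁ f)
  Phi : ∀ {x y : Ob} (f : T.Hom x y), 𝟙 f ≅ T.zigzag f (inv₁ f) (eps f).hom (eta f).hom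
  Theta : ∀ {x y : Ob} (f : T.Hom x y),
    𝟙 (inv₁ f) ≅ T.zagzig f (inv₁ f) (eps f).hom (eta f).hom
  /-- the swallowtail identity -/
  swallowtail : ∀ {x y : Ob} (f : T.Hom x y),
    T.swallowtail f (inv₁ f) (eps f).hom (eta f).hom (Phi f) (Theta f) = 𝟙 _

end Tricat

/-! ### Super tricategories -/

namespace SuperGeometry

open Tricat Tricat.TricatBase

/-- Let `R n p q` say that the operation sends `p` to `q`, for `A`-points and `A = Λ ℝⁿ`. The
operation is a map of supermanifolds: the set of `A`-points of `X` on which it is defined is that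
of a supermanifold `P` with a map `ι : P → X` through which the maps into `X` with values in this
set factor, and the operation is a map of supermanifolds on `P`. -/
def IsSmoothOp (X M : SuperManifold.{u}) (R : ∀ n, X.pts n → M.pts n → Prop) : Prop :=
  ∃ (P : SuperManifold.{u}) (ι : SMap P X) (φ : SMap P M),
    (∀ n, Function.Injective (ι n)) ∧
    (∀ n p q, R n p q ↔ ∃ p', ι n p' = p ∧ φ n p' = q) ∧
    ∀ (Y : SuperManifold.{u}) (ψ : SMap Y X), (∀ n y, ∃ q, R n (ψ n y) q) →
      ∃ χ : SMap Y P, ∀ n y, ι n (χ n y) = ψ n y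

/-- Supermanifolds of objects, morphisms, 2-morphisms and 3-morphisms with source and target
maps. -/
structure SuperGlob where
  T0 : SuperManifold.{u}
  T1 : SuperManifold.{u}
  T2 : SuperManifold.{u}
  T3 : SuperManifold.{u}
  s1 : SMap T1 T0
  t1 : SMap T1 T0
  s2 : SMap T2 T1
  t2 : SMap T2 T1
  s3 : SMap T3 T2
  t3 : SMap T3 T2
  glob₂_s : ∀ n x, s1 n (s2 n x) = s1 n (t2 n x)
  glob₂_t : ∀ n x, t1 n (s2 n x) = t1 n (t2 n x)
  glob₃_s : ∀ n x, s2 n (s3 n x) = s2 n (t3 n x)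
  glob₃_t : ∀ n x, t2 n (s3 n x) = t2 n (t3 n x)

namespace SuperGlob

variable (X : SuperGlob.{u})

/-- The `A`-points of the supermanifold of morphisms with given source and target. -/
def Cell1 (n : ℕ) (x y : X.T0.pts n) : Type u := {p : X.T1.pts n // X.s1 n p = x ∧ X.t1 n p = y}

/-- The `A`-points of the supermanifold of 2-morphisms with given source and target. -/
def Cell2 (n : ℕ) (f g : X.T1.pts n) : Type u := {p : X.T2.pts n // X.s2 n p = f ∧ X.t2 n p = g}

/-- The `A`-points of the supermanifold of 3-morphisms with given source and target. -/
def Cell3 (n : ℕ) (α β : X.T2.pts n) : Type u := {p : X.T3.pts n // X.s3 n p = α ∧ X.t3 n p = β}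

end SuperGlob

/-- For every Grassmann algebra `A`, a tricategory whose cells are the `A`-points of given
supermanifolds. -/
structure TricatOn (X : SuperGlob.{u}) where
  tri : ∀ n, Tricategory (X.T0.pts n)
  cell₁ : ∀ {n : ℕ} {x y : X.T0.pts n}, (tri n).Hom x y ≃ X.Cell1 n x y
  cell₂ : ∀ {n : ℕ} {x y : X.T0.pts n} {f g : (tri n).Hom x y},
    (f ⟶ g) ≃ X.Cell2 n (cell₁ f).1 (cell₁ g).1
  cell₃ : ∀ {n : ℕ} {x y : X.T0.pts n} {f g : (tri n).Hom x y} {α β : f ⟶ g},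
    (α ⟶ β) ≃ X.Cell3 n (cell₂ α).1 (cell₂ β).1

namespace TricatOn

variable {X : SuperGlob.{u}} (S : TricatOn X) {n : ℕ} {x y : X.T0.pts n}

/-- The `A`-point that is a morphism. -/
def c₁ (f : (S.tri n).Hom x y) : X.T1.pts n := (S.cell₁ f).1

/-- The `A`-point that is a 2-morphism. -/
def c₂ {f g : (S.tri n).Hom x y} (α : f ⟶ g) : X.T2.pts n := (S.cell₂ α).1

/-- The `A`-point that is a 3-morphism. -/
def c₃ {f g : (S.tri n).Hom x y} {α β : f ⟶ g} (Γ : α ⟶ β) : X.T3.pts n := (S.cell₃ Γ).1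

/-- The `A`-point of `T₃ × T₃` that is an invertible 3-morphism with its inverse. -/
def cIso {f g : (S.tri n).Hom x y} {α β : f ⟶ g} (Γ : α ≅ β) : (X.T3.prod X.T3).pts n :=
  (S.c₃ Γ.hom, S.c₃ Γ.inv)

/-- The `A`-point of `T₂² × T₃⁴` that is an adjoint equivalence. -/
def cEquiv {f g : (S.tri n).Hom x y} (e : f ≌ g) :
    ((X.T2.prod X.T2).prod ((X.T3.prod X.T3).prod (X.T3.prod X.T3))).pts n :=
  ((S.c₂ e.hom, S.c₂ e.inv), (S.cIso e.unit, S.cIso e.counit))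

end TricatOn

/-- A super tricategory: all structure maps are maps of supermanifolds. -/
structure SuperTricategory (X : SuperGlob.{u}) extends TricatOn X where
  -- identities
  smooth_one : IsSmoothOp X.T0 X.T1 fun n p q => q = toTricatOn.c₁ ((tri n).one p)
  smooth_id₂ : IsSmoothOp X.T1 X.T2 fun n p q => ∃ (x y : X.T0.pts n) (f : (tri n).Hom x y),
    p = toTricatOn.c₁ f ∧ q = toTricatOn.c₂ (𝟙 f)
  smooth_id₃ : IsSmoothOp X.T2 X.T3 fun n p q => ∃ (x y : X.T0.pts n) (f g : (tri n).Hom x y)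
    (α : f ⟶ g), p = toTricatOn.c₂ α ∧ q = toTricatOn.c₃ (𝟙 α)
  -- composition at a 2-cell
  smooth_comp₂₃ : IsSmoothOp (X.T3.prod X.T3) X.T3 fun n p q =>
    ∃ (x y : X.T0.pts n) (f g : (tri n).Hom x y) (α β γ : f ⟶ g) (Γ : α ⟶ β) (Γ' : β ⟶ γ),
      p = (toTricatOn.c₃ Γ, toTricatOn.c₃ Γ') ∧ q = toTricatOn.c₃ (Γ ≫ Γ')
  -- composition at a 1-cell
  smooth_comp₁₂ : IsSmoothOp (X.T2.prod X.T2) X.T2 fun n p q =>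
    ∃ (x y : X.T0.pts n) (f g h : (tri n).Hom x y) (α : f ⟶ g) (β : g ⟶ h),
      p = (toTricatOn.c₂ α, toTricatOn.c₂ β) ∧ q = toTricatOn.c₂ (α ≫ β)
  smooth_comp₁₃ : IsSmoothOp (X.T3.prod X.T3) X.T3 fun n p q =>
    ∃ (x y : X.T0.pts n) (f g h : (tri n).Hom x y) (α α' : f ⟶ g) (β β' : g ⟶ h) (Γ : α ⟶ α')
      (Γ' : β ⟶ β'),
      p = (toTricatOn.c₃ Γ, toTricatOn.c₃ Γ') ∧ q = toTricatOn.c₃ (Γ ▷ β ≫ α' ◁ Γ')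
  smooth_assoc : IsSmoothOp (X.T2.prod (X.T2.prod X.T2)) (X.T3.prod X.T3) fun n p q =>
    ∃ (x y : X.T0.pts n) (f g h k : (tri n).Hom x y) (α : f ⟶ g) (β : g ⟶ h) (γ : h ⟶ k),
      p = (toTricatOn.c₂ α, toTricatOn.c₂ β, toTricatOn.c₂ γ) ∧ q = toTricatOn.cIso (α_ α β γ)
  smooth_left : IsSmoothOp X.T2 (X.T3.prod X.T3) fun n p q =>
    ∃ (x y : X.T0.pts n) (f g : (tri n).Hom x y) (α : f ⟶ g),
      p = toTricatOn.c₂ α ∧ q = toTricatOn.cIso (λ_ α)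
  smooth_right : IsSmoothOp X.T2 (X.T3.prod X.T3) fun n p q =>
    ∃ (x y : X.T0.pts n) (f g : (tri n).Hom x y) (α : f ⟶ g),
      p = toTricatOn.c₂ α ∧ q = toTricatOn.cIso (ρ_ α)
  -- composition at a 0-cell
  smooth_comp₀₁ : IsSmoothOp (X.T1.prod X.T1) X.T1 fun n p q =>
    ∃ (x y z : X.T0.pts n) (f : (tri n).Hom x y) (g : (tri n).Hom y z),
      p = (toTricatOn.c₁ f, toTricatOn.c₁ g) ∧ q = toTricatOn.c₁ (o f g)
  smooth_comp₀₂ : IsSmoothOp (X.T2.prod X.T2) X.T2 fun n p q =>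
    ∃ (x y z : X.T0.pts n) (f f' : (tri n).Hom x y) (g g' : (tri n).Hom y z) (α : f ⟶ f')
      (β : g ⟶ g'), p = (toTricatOn.c₂ α, toTricatOn.c₂ β) ∧ q = toTricatOn.c₂ (o₂ α β)
  smooth_comp₀₃ : IsSmoothOp (X.T3.prod X.T3) X.T3 fun n p q =>
    ∃ (x y z : X.T0.pts n) (f f' : (tri n).Hom x y) (g g' : (tri n).Hom y z) (α α' : f ⟶ f')
      (β β' : g ⟶ g') (Γ : α ⟶ α') (Γ' : β ⟶ β'),
      p = (toTricatOn.c₃ Γ, toTricatOn.c₃ Γ') ∧ q = toTricatOn.c₃ (o₃ Γ Γ')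
  smooth_oId : IsSmoothOp (X.T1.prod X.T1) (X.T3.prod X.T3) fun n p q =>
    ∃ (x y z : X.T0.pts n) (f : (tri n).Hom x y) (g : (tri n).Hom y z),
      p = (toTricatOn.c₁ f, toTricatOn.c₁ g) ∧ q = toTricatOn.cIso (oId f g)
  smooth_oComp : IsSmoothOp ((X.T2.prod X.T2).prod (X.T2.prod X.T2)) (X.T3.prod X.T3) fun n p q =>
    ∃ (x y z : X.T0.pts n) (f f' f'' : (tri n).Hom x y) (g g' g'' : (tri n).Hom y z)
      (α : f ⟶ f') (α' : f' ⟶ f'') (β : g ⟶ g') (β' : g' ⟶ g''),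
      p = ((toTricatOn.c₂ α, toTricatOn.c₂ α'), (toTricatOn.c₂ β, toTricatOn.c₂ β')) ∧
        q = toTricatOn.cIso (oComp α α' β β')
  -- associator
  smooth_a : IsSmoothOp (X.T1.prod (X.T1.prod X.T1)) (X.T2.prod X.T2) fun n p q =>
    ∃ (x y z w : X.T0.pts n) (f : (tri n).Hom x y) (g : (tri n).Hom y z) (h : (tri n).Hom z w),
      p = (toTricatOn.c₁ f, toTricatOn.c₁ g, toTricatOn.c₁ h) ∧
        q = (toTricatOn.c₂ ((tri n).a f g h), toTricatOn.c₂ ((tri n).a' f g h))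
  smooth_aAdj : IsSmoothOp (X.T1.prod (X.T1.prod X.T1))
      ((X.T3.prod X.T3).prod (X.T3.prod X.T3)) fun n p q =>
    ∃ (x y z w : X.T0.pts n) (f : (tri n).Hom x y) (g : (tri n).Hom y z) (h : (tri n).Hom z w),
      p = (toTricatOn.c₁ f, toTricatOn.c₁ g, toTricatOn.c₁ h) ∧
        q = (toTricatOn.cIso ((tri n).aUnit f g h), toTricatOn.cIso ((tri n).aCounit f g h))
  smooth_aNat : IsSmoothOp (X.T2.prod (X.T2.prod X.T2))
      ((X.T3.prod X.T3).prod (X.T3.prod X.T3)) fun n p q =>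
    ∃ (x y z w : X.T0.pts n) (f f' : (tri n).Hom x y) (g g' : (tri n).Hom y z)
      (h h' : (tri n).Hom z w) (α : f ⟶ f') (β : g ⟶ g') (γ : h ⟶ h'),
      p = (toTricatOn.c₂ α, toTricatOn.c₂ β, toTricatOn.c₂ γ) ∧
        q = (toTricatOn.cIso ((tri n).aNat α β γ), toTricatOn.cIso ((tri n).aNat' α β γ))
  -- left unitor
  smooth_l : IsSmoothOp X.T1 (X.T2.prod X.T2) fun n p q =>
    ∃ (x y : X.T0.pts n) (f : (tri n).Hom x y),
      p = toTricatOn.c₁ f ∧ q = (toTricatOn.c₂ ((tri n).l f), toTricatOn.c₂ ((tri n).l' f))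
  smooth_lAdj : IsSmoothOp X.T1 ((X.T3.prod X.T3).prod (X.T3.prod X.T3)) fun n p q =>
    ∃ (x y : X.T0.pts n) (f : (tri n).Hom x y), p = toTricatOn.c₁ f ∧
      q = (toTricatOn.cIso ((tri n).lUnit f), toTricatOn.cIso ((tri n).lCounit f))
  smooth_lNat : IsSmoothOp X.T2 ((X.T3.prod X.T3).prod (X.T3.prod X.T3)) fun n p q =>
    ∃ (x y : X.T0.pts n) (f f' : (tri n).Hom x y) (α : f ⟶ f'), p = toTricatOn.c₂ α ∧
      q = (toTricatOn.cIso ((tri n).lNat α), toTricatOn.cIso ((tri n).lNat' α))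
  -- right unitor
  smooth_r : IsSmoothOp X.T1 (X.T2.prod X.T2) fun n p q =>
    ∃ (x y : X.T0.pts n) (f : (tri n).Hom x y),
      p = toTricatOn.c₁ f ∧ q = (toTricatOn.c₂ ((tri n).r f), toTricatOn.c₂ ((tri n).r' f))
  smooth_rAdj : IsSmoothOp X.T1 ((X.T3.prod X.T3).prod (X.T3.prod X.T3)) fun n p q =>
    ∃ (x y : X.T0.pts n) (f : (tri n).Hom x y), p = toTricatOn.c₁ f ∧
      q = (toTricatOn.cIso ((tri n).rUnit f), toTricatOn.cIso ((tri n).rCounit f))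
  smooth_rNat : IsSmoothOp X.T2 ((X.T3.prod X.T3).prod (X.T3.prod X.T3)) fun n p q =>
    ∃ (x y : X.T0.pts n) (f f' : (tri n).Hom x y) (α : f ⟶ f'), p = toTricatOn.c₂ α ∧
      q = (toTricatOn.cIso ((tri n).rNat α), toTricatOn.cIso ((tri n).rNat' α))
  -- pentagonator and triangulators
  smooth_pi : IsSmoothOp (X.T1.prod (X.T1.prod (X.T1.prod X.T1))) (X.T3.prod X.T3) fun n p q =>
    ∃ (x y z w v : X.T0.pts n) (f : (tri n).Hom x y) (g : (tri n).Hom y z) (h : (tri n).Hom z w)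
      (k : (tri n).Hom w v),
      p = (toTricatOn.c₁ f, toTricatOn.c₁ g, toTricatOn.c₁ h, toTricatOn.c₁ k) ∧
        q = toTricatOn.cIso ((tri n).pi f g h k)
  smooth_lam : IsSmoothOp (X.T1.prod X.T1) (X.T3.prod X.T3) fun n p q =>
    ∃ (x y z : X.T0.pts n) (f : (tri n).Hom x y) (g : (tri n).Hom y z),
      p = (toTricatOn.c₁ f, toTricatOn.c₁ g) ∧ q = toTricatOn.cIso ((tri n).lam f g)
  smooth_mu : IsSmoothOp (X.T1.prod X.T1) (X.T3.prod X.T3) fun n p q =>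
    ∃ (x y z : X.T0.pts n) (f : (tri n).Hom x y) (g : (tri n).Hom y z),
      p = (toTricatOn.c₁ f, toTricatOn.c₁ g) ∧ q = toTricatOn.cIso ((tri n).mu f g)
  smooth_rho : IsSmoothOp (X.T1.prod X.T1) (X.T3.prod X.T3) fun n p q =>
    ∃ (x y z : X.T0.pts n) (f : (tri n).Hom x y) (g : (tri n).Hom y z),
      p = (toTricatOn.c₁ f, toTricatOn.c₁ g) ∧ q = toTricatOn.cIso ((tri n).rho f g)

/-- A 3-supergroup: a super tricategory with one object, with maps of supermanifolds choosing
(weak) inverses of all morphisms, 2-morphisms and 3-morphisms. -/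
structure ThreeSupergroup (X : SuperGlob.{u}) extends SuperTricategory X where
  one_object : ∀ n, ∃! x : X.T0.pts n, x = x
  inverses : ∀ n, TricatInverses (tri n)
  smooth_inv₃ : IsSmoothOp X.T3 X.T3 fun n p q =>
    ∃ (x y : X.T0.pts n) (f g : (tri n).Hom x y) (α β : f ⟶ g) (Γ : α ⟶ β),
      p = toTricatOn.c₃ Γ ∧ q = toTricatOn.c₃ ((inverses n).inv₃ Γ)
  smooth_inv₂ : IsSmoothOp X.T2 (X.T2.prod ((X.T3.prod X.T3).prod (X.T3.prod X.T3))) fun n p q =>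
    ∃ (x y : X.T0.pts n) (f g : (tri n).Hom x y) (α : f ⟶ g), p = toTricatOn.c₂ α ∧
      q = (toTricatOn.c₂ ((inverses n).inv₂ α), toTricatOn.cIso ((inverses n).counit₂ α),
        toTricatOn.cIso ((inverses n).unit₂ α))
  smooth_inv₁ : IsSmoothOp X.T1 X.T1 fun n p q =>
    ∃ (x y : X.T0.pts n) (f : (tri n).Hom x y),
      p = toTricatOn.c₁ f ∧ q = toTricatOn.c₁ ((inverses n).inv₁ f)
  smooth_eps : IsSmoothOp X.T1
      ((X.T2.prod X.T2).prod ((X.T3.prod X.T3).prod (X.T3.prod X.T3))) fun n p q =>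
    ∃ (x y : X.T0.pts n) (f : (tri n).Hom x y),
      p = toTricatOn.c₁ f ∧ q = toTricatOn.cEquiv ((inverses n).eps f)
  smooth_eta : IsSmoothOp X.T1
      ((X.T2.prod X.T2).prod ((X.T3.prod X.T3).prod (X.T3.prod X.T3))) fun n p q =>
    ∃ (x y : X.T0.pts n) (f : (tri n).Hom x y),
      p = toTricatOn.c₁ f ∧ q = toTricatOn.cEquiv ((inverses n).eta f)
  smooth_Phi : IsSmoothOp X.T1 (X.T3.prod X.T3) fun n p q =>
    ∃ (x y : X.T0.pts n) (f : (tri n).Hom x y),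
      p = toTricatOn.c₁ f ∧ q = toTricatOn.cIso ((inverses n).Phi f)
  smooth_Theta : IsSmoothOp X.T1 (X.T3.prod X.T3) fun n p q =>
    ∃ (x y : X.T0.pts n) (f : (tri n).Hom x y),
      p = toTricatOn.c₁ f ∧ q = toTricatOn.cIso ((inverses n).Theta f)

/-! ### Supergroups and supergroup cochains -/

/-- A supergroup: a group object in supermanifolds. -/
structure Supergroup where
  carrier : SuperManifold.{u}
  mul : SMap (carrier.prod carrier) carrier
  inv : SMap carrier carrier
  one : SMap SuperManifold.point.{u} carrier
  mul_assoc' : ∀ n (x y z : carrier.pts n), mul n (mul n (x, y), z) = mul n (x, mul n (y, z))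
  one_mul' : ∀ n (x : carrier.pts n), mul n (one n PUnit.unit, x) = x
  mul_one' : ∀ n (x : carrier.pts n), mul n (x, one n PUnit.unit) = x
  inv_mul' : ∀ n (x : carrier.pts n), mul n (inv n x, x) = one n PUnit.unit

/-- The group `G_A` of `A`-points of a supergroup. -/
instance Supergroup.groupPts (G : Supergroup.{u}) (n : ℕ) : Group (G.carrier.pts n) :=
  letI : Mul (G.carrier.pts n) := ⟨fun x y => G.mul n (x, y)⟩
  letI : One (G.carrier.pts n) := ⟨G.one n PUnit.unit⟩
  letI : Inv (G.carrier.pts n) := ⟨fun x => G.inv n x⟩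
  Group.ofLeftAxioms (G.mul_assoc' n) (G.one_mul' n) (G.inv_mul' n)

/-- An abelian supergroup. -/
structure AbelianSupergroup extends Supergroup.{u} where
  mul_comm' : ∀ n (x y : carrier.pts n), mul n (x, y) = mul n (y, x)

/-- The group `H_A` of `A`-points of an abelian supergroup, written additively. -/
instance AbelianSupergroup.addCommGroupPts (H : AbelianSupergroup.{u}) (n : ℕ) :
    AddCommGroup (H.carrier.pts n) :=
  letI : CommGroup (H.carrier.pts n) :=
    { H.toSupergroup.groupPts n with mul_comm := H.mul_comm' n }
  inferInstanceAs (AddCommGroup (Additive (H.carrier.pts n)))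

/-- An action by automorphisms of a supergroup on an abelian supergroup. -/
structure SuperAction (G : Supergroup.{u}) (H : AbelianSupergroup.{u}) where
  act : SMap (G.carrier.prod H.carrier) H.carrier
  one_act : ∀ n (h : H.carrier.pts n), act n (1, h) = h
  mul_act : ∀ n (g g' : G.carrier.pts n) (h : H.carrier.pts n),
    act n (g * g', h) = act n (g, act n (g', h))
  act_add : ∀ n (g : G.carrier.pts n) (h h' : H.carrier.pts n),
    act n (g, h + h') = act n (g, h) + act n (g, h')

/-- Supergroup 4-cochains: maps of supermanifolds from `G⁴` to `H`. -/
abbrev Cochain4 (G : Supergroup.{u}) (H : AbelianSupergroup.{u}) : Type u :=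
  SMap (G.carrier.prod (G.carrier.prod (G.carrier.prod G.carrier))) H.carrier

namespace Cochain4

variable {G : Supergroup.{u}} {H : AbelianSupergroup.{u}}

/-- The 4-cochain `c` is normalized: it vanishes if one of the arguments is `1`. -/
def IsNormalized (c : Cochain4 G H) : Prop :=
  ∀ n (g₁ g₂ g₃ g₄ : G.carrier.pts n), g₁ = 1 ∨ g₂ = 1 ∨ g₃ = 1 ∨ g₄ = 1 →
    c n (g₁, g₂, g₃, g₄) = 0

/-- The 4-cochain `c` is a cocycle: its differential vanishes on `A`-points. -/
def IsCocycle (c : Cochain4 G H) (ρ : SuperAction G H) : Prop :=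
  ∀ n (g₁ g₂ g₃ g₄ g₅ : G.carrier.pts n),
    ρ.act n (g₁, c n (g₂, g₃, g₄, g₅)) - c n (g₁ * g₂, g₃, g₄, g₅) + c n (g₁, g₂ * g₃, g₄, g₅) -
      c n (g₁, g₂, g₃ * g₄, g₅) + c n (g₁, g₂, g₃, g₄ * g₅) - c n (g₁, g₂, g₃, g₄) = 0

end Cochain4

/-! ### The slim construction -/

/-- One object, morphisms and 2-morphisms `G`, 3-morphisms `G × H`. Sources and targets of
2-morphisms are given by the identity, those of 3-morphisms by projection to `G`. -/
def braneGlob (G : Supergroup.{u}) (H : AbelianSupergroup.{u}) : SuperGlob.{u} where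
  T0 := SuperManifold.point
  T1 := G.carrier
  T2 := G.carrier
  T3 := G.carrier.prod H.carrier
  s1 := SMap.toPoint G.carrier
  t1 := SMap.toPoint G.carrier
  s2 := SMap.id G.carrier
  t2 := SMap.id G.carrier
  s3 := SMap.fst G.carrier H.carrier
  t3 := SMap.fst G.carrier H.carrier
  glob₂_s _ _ := rfl
  glob₂_t _ _ := rfl
  glob₃_s _ _ := rfl
  glob₃_t _ _ := rfl

namespace ThreeSupergroup

variable {G : Supergroup.{u}} {H : AbelianSupergroup.{u}} (S : ThreeSupergroup (braneGlob G H))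
  {n : ℕ} {x y : (braneGlob G H).T0.pts n}

/-- The `A`-point of `G` that is a morphism. -/
def gPart (f : (S.tri n).Hom x y) : G.carrier.pts n := S.c₁ f

/-- The `A`-point of `G` that is a 2-morphism. -/
def gPart₂ {f g : (S.tri n).Hom x y} (α : f ⟶ g) : G.carrier.pts n := S.c₂ α

/-- The `H`-component of a 3-morphism, an `A`-point of `G × H`. -/
def hPart {f g : (S.tri n).Hom x y} {α β : f ⟶ g} (Γ : α ⟶ β) : H.carrier.pts n := (S.c₃ Γ).2

/-- The `G`-component of a 3-morphism, an `A`-point of `G × H`. -/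
def gPart₃ {f g : (S.tri n).Hom x y} {α β : f ⟶ g} (Γ : α ⟶ β) : G.carrier.pts n := (S.c₃ Γ).1

/-- The 3-supergroup `S` has the structure maps of `Brane_π(G, H)`, for the action `ρ` and the
4-cochain `c = π`. -/
structure IsBrane (ρ : SuperAction G H) (c : Cochain4 G H) : Prop where
  -- identities
  one : ∀ n (x : (braneGlob G H).T0.pts n), S.gPart ((S.tri n).one x) = 1
  id₂ : ∀ n (x y : (braneGlob G H).T0.pts n) (f : (S.tri n).Hom x y), S.gPart₂ (𝟙 f) = S.gPart f
  id₃ : ∀ n (x y : (braneGlob G H).T0.pts n) (f g : (S.tri n).Hom x y) (α : f ⟶ g),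
    S.gPart₃ (𝟙 α) = S.gPart₂ α ∧ S.hPart (𝟙 α) = 0
  -- composition at a 2-cell and at a 1-cell
  comp₂₃ : ∀ n (x y : (braneGlob G H).T0.pts n) (f g : (S.tri n).Hom x y) (α β γ : f ⟶ g)
    (Γ : α ⟶ β) (Γ' : β ⟶ γ), S.hPart (Γ ≫ Γ') = S.hPart Γ + S.hPart Γ'
  comp₁₂ : ∀ n (x y : (braneGlob G H).T0.pts n) (f g h : (S.tri n).Hom x y) (α : f ⟶ g)
    (β : g ⟶ h), S.gPart₂ (α ≫ β) = S.gPart₂ α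
  comp₁₃ : ∀ n (x y : (braneGlob G H).T0.pts n) (f g h : (S.tri n).Hom x y) (α α' : f ⟶ g)
    (β β' : g ⟶ h) (Γ : α ⟶ α') (Γ' : β ⟶ β'),
    S.hPart (Γ ▷ β ≫ α' ◁ Γ') = S.hPart Γ + S.hPart Γ'
  -- composition at a 0-cell
  comp₀₁ : ∀ n (x y z : (braneGlob G H).T0.pts n) (f : (S.tri n).Hom x y) (g : (S.tri n).Hom y z),
    S.gPart (o f g) = S.gPart f * S.gPart g
  comp₀₂ : ∀ n (x y z : (braneGlob G H).T0.pts n) (f f' : (S.tri n).Hom x y)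
    (g g' : (S.tri n).Hom y z) (α : f ⟶ f') (β : g ⟶ g'),
    S.gPart₂ (o₂ α β) = S.gPart₂ α * S.gPart₂ β
  comp₀₃ : ∀ n (x y z : (braneGlob G H).T0.pts n) (f f' : (S.tri n).Hom x y)
    (g g' : (S.tri n).Hom y z) (α α' : f ⟶ f') (β β' : g ⟶ g') (Γ : α ⟶ α') (Γ' : β ⟶ β'),
    S.gPart₃ (o₃ Γ Γ') = S.gPart₃ Γ * S.gPart₃ Γ' ∧
      S.hPart (o₃ Γ Γ') = S.hPart Γ + ρ.act n (S.gPart₃ Γ, S.hPart Γ')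
  -- the remaining structure is trivial, except for the pentagonator and the cell `Φ`
  assoc₁ : ∀ n (x y : (braneGlob G H).T0.pts n) (f g h k : (S.tri n).Hom x y) (α : f ⟶ g)
    (β : g ⟶ h) (γ : h ⟶ k), S.hPart (α_ α β γ).hom = 0
  left₁ : ∀ n (x y : (braneGlob G H).T0.pts n) (f g : (S.tri n).Hom x y) (α : f ⟶ g),
    S.hPart (λ_ α).hom = 0
  right₁ : ∀ n (x y : (braneGlob G H).T0.pts n) (f g : (S.tri n).Hom x y) (α : f ⟶ g),
    S.hPart (ρ_ α).hom = 0
  oId : ∀ n (x y z : (braneGlob G H).T0.pts n) (f : (S.tri n).Hom x y) (g : (S.tri n).Hom y z),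
    S.hPart (oId f g).hom = 0
  oComp : ∀ n (x y z : (braneGlob G H).T0.pts n) (f f' f'' : (S.tri n).Hom x y)
    (g g' g'' : (S.tri n).Hom y z) (α : f ⟶ f') (α' : f' ⟶ f'') (β : g ⟶ g') (β' : g' ⟶ g''),
    S.hPart (oComp α α' β β').hom = 0
  a : ∀ n (x y z w : (braneGlob G H).T0.pts n) (f : (S.tri n).Hom x y) (g : (S.tri n).Hom y z)
    (h : (S.tri n).Hom z w), S.hPart ((S.tri n).aUnit f g h).hom = 0 ∧
      S.hPart ((S.tri n).aCounit f g h).hom = 0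
  aNat : ∀ n (x y z w : (braneGlob G H).T0.pts n) (f f' : (S.tri n).Hom x y)
    (g g' : (S.tri n).Hom y z) (h h' : (S.tri n).Hom z w) (α : f ⟶ f') (β : g ⟶ g') (γ : h ⟶ h'),
    S.hPart ((S.tri n).aNat α β γ).hom = 0 ∧ S.hPart ((S.tri n).aNat' α β γ).hom = 0
  l : ∀ n (x y : (braneGlob G H).T0.pts n) (f : (S.tri n).Hom x y),
    S.hPart ((S.tri n).lUnit f).hom = 0 ∧ S.hPart ((S.tri n).lCounit f).hom = 0
  lNat : ∀ n (x y : (braneGlob G H).T0.pts n) (f f' : (S.tri n).Hom x y) (α : f ⟶ f'),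
    S.hPart ((S.tri n).lNat α).hom = 0 ∧ S.hPart ((S.tri n).lNat' α).hom = 0
  r : ∀ n (x y : (braneGlob G H).T0.pts n) (f : (S.tri n).Hom x y),
    S.hPart ((S.tri n).rUnit f).hom = 0 ∧ S.hPart ((S.tri n).rCounit f).hom = 0
  rNat : ∀ n (x y : (braneGlob G H).T0.pts n) (f f' : (S.tri n).Hom x y) (α : f ⟶ f'),
    S.hPart ((S.tri n).rNat α).hom = 0 ∧ S.hPart ((S.tri n).rNat' α).hom = 0
  triangulators : ∀ n (x y z : (braneGlob G H).T0.pts n) (f : (S.tri n).Hom x y)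
    (g : (S.tri n).Hom y z), S.hPart ((S.tri n).lam f g).hom = 0 ∧
      S.hPart ((S.tri n).mu f g).hom = 0 ∧ S.hPart ((S.tri n).rho f g).hom = 0
  pentagonator : ∀ n (x y z w v : (braneGlob G H).T0.pts n) (f : (S.tri n).Hom x y)
    (g : (S.tri n).Hom y z) (h : (S.tri n).Hom z w) (k : (S.tri n).Hom w v),
    S.hPart ((S.tri n).pi f g h k).hom = c n (S.gPart f, S.gPart g, S.gPart h, S.gPart k)
  -- inverses
  inv₃ : ∀ n (x y : (braneGlob G H).T0.pts n) (f g : (S.tri n).Hom x y) (α β : f ⟶ g) (Γ : α ⟶ β),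
    S.gPart₃ ((S.inverses n).inv₃ Γ) = S.gPart₃ Γ ∧
      S.hPart ((S.inverses n).inv₃ Γ) = -S.hPart Γ
  inv₂ : ∀ n (x y : (braneGlob G H).T0.pts n) (f g : (S.tri n).Hom x y) (α : f ⟶ g),
    S.gPart₂ ((S.inverses n).inv₂ α) = S.gPart₂ α ∧
      S.hPart ((S.inverses n).counit₂ α).hom = 0 ∧ S.hPart ((S.inverses n).unit₂ α).hom = 0
  inv₁ : ∀ n (x y : (braneGlob G H).T0.pts n) (f : (S.tri n).Hom x y),
    S.gPart ((S.inverses n).inv₁ f) = (S.gPart f)⁻¹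
  eps : ∀ n (x y : (braneGlob G H).T0.pts n) (f : (S.tri n).Hom x y),
    S.hPart ((S.inverses n).eps f).unit.hom = 0 ∧ S.hPart ((S.inverses n).eps f).counit.hom = 0
  eta : ∀ n (x y : (braneGlob G H).T0.pts n) (f : (S.tri n).Hom x y),
    S.hPart ((S.inverses n).eta f).unit.hom = 0 ∧ S.hPart ((S.inverses n).eta f).counit.hom = 0
  Phi : ∀ n (x y : (braneGlob G H).T0.pts n) (f : (S.tri n).Hom x y),
    S.hPart ((S.inverses n).Phi f).hom =
      -c n (S.gPart f, (S.gPart f)⁻¹, S.gPart f, (S.gPart f)⁻¹)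
  Theta : ∀ n (x y : (braneGlob G H).T0.pts n) (f : (S.tri n).Hom x y),
    S.hPart ((S.inverses n).Theta f).hom = 0

end ThreeSupergroup

end SuperGeometry

end

/-! On `A`-points a 2-morphism of the brane is only an equality between elements of `G`, and a
3-morphism carries, beyond the element of `G` under it, one element of `H`, its value. An equation
between parallel 3-morphisms is therefore an equation in the abelian group `H`. Values add under
composition at 2-cells and at 1-cells; at a 0-cell they add after the left morphism has acted on the
value of the right factor. Every constraint cell other than the pentagonator has value zero. So the
value of a pasting is a sum over the occurrences of `π` in it, each twisted by the morphism to its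
left, and the order of pasting is irrelevant.

With this rule the pentagonator identity reads `π(f,g,h,k) + π(f,g,hk,p) + π(fg,h,k,p) = f
π(g,h,k,p) + π(f,gh,k,p) + π(f,g,h,kp)`, which is the cocycle condition. The normalization axioms
become `π(f,1,g,h) = 0` and `π(f,g,1,h) = 0`, and the swallowtail identity becomes `Φ(f) +
π(f,f⁻¹,f,f⁻¹) - f Θ(f) = 0`, which explains the choice of `Φ`. The modification axioms hold because
source and target of a 2-morphism coincide.

The evaluation is carried out once, for an abstract value function `TricatValue`, and serves both
directions. For an explicit model built on the bicategory `Shift G H` the value is faithful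
(`shiftCells_hom_ext`), so the computed equations in `H` prove the axioms. For an arbitrary
3-supergroup with the structure maps of the brane, `IsBrane.value` supplies the value; applied to
the pentagonator axiom it gives the cocycle condition (`TricatValue.pentagonator_iff`), at all
points of `G` because every such point is an endomorphism of the single object.

Smoothness needs no general pullbacks. The domain of each operation is the ambient product or a
retract of it: a diagonal in powers of `G`, or `G × (H × H)` inside `(G × H)²`. The operations
themselves are composed from multiplication, inversion, action and `π` by projections and pairings.
-/

noncomputable section

/-! ### The bicategory with objects `G`, identity 1-morphisms only, and 2-morphisms `H` -/

namespace Tricat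

/-- The objects of the bicategory whose only 1-morphisms are identities and whose 2-morphisms are
the elements of `H`: a copy of `G`. -/
structure Shift (G H : Type u) : Type u where
  pt : G

namespace Shift

variable {G H : Type u}

/-- A 1-morphism is an equality of objects. -/
structure Hom₁ (f g : Shift G H) : Type u where
  eq : f = g

/-- A 2-morphism is an element of `H`. -/
structure Hom₂ {f g : Shift G H} (α β : Hom₁ f g) : Type u where
  val : H

attribute [ext] Hom₂

instance (f g : Shift G H) : Subsingleton (Hom₁ f g) := ⟨fun ⟨_⟩ ⟨_⟩ => rfl⟩

instance : CategoryStruct (Shift G H) where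
  Hom := Hom₁
  id _ := ⟨rfl⟩
  comp α β := ⟨α.eq.trans β.eq⟩

instance (f g : Shift G H) : Subsingleton (f ⟶ g) := inferInstanceAs (Subsingleton (Hom₁ f g))

variable [AddCommGroup H]

instance homCategory (f g : Shift G H) : Category.{u} (f ⟶ g) where
  Hom := Hom₂
  id _ := ⟨0⟩
  comp Γ Γ' := ⟨Γ.val + Γ'.val⟩
  id_comp _ := Hom₂.ext (zero_add _)
  comp_id _ := Hom₂.ext (add_zero _)
  assoc _ _ _ := Hom₂.ext (add_assoc _ _ _)

/-- The element of `H` that is a 2-morphism. -/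
def val {f g : Shift G H} {α β : f ⟶ g} (Γ : α ⟶ β) : H := Hom₂.val Γ

/-- The 2-morphism given by an element of `H`. -/
def ofVal {f g : Shift G H} (α β : f ⟶ g) (h : H) : α ⟶ β := Hom₂.mk h

theorem hom_ext {f g : Shift G H} {α β : f ⟶ g} {Γ Γ' : α ⟶ β} (h : val Γ = val Γ') : Γ = Γ' :=
  Hom₂.ext h

@[simp] theorem val_ofVal {f g : Shift G H} (α β : f ⟶ g) (h : H) : val (ofVal α β h) = h := rfl
@[simp] theorem val_id {f g : Shift G H} (α : f ⟶ g) : val (𝟙 α) = 0 := rfl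
@[simp] theorem val_comp {f g : Shift G H} {α β γ : f ⟶ g} (Γ : α ⟶ β) (Γ' : β ⟶ γ) :
    val (Γ ≫ Γ') = val Γ + val Γ' := rfl

/-- The invertible 2-morphism given by an element of `H`. -/
@[simps]
def isoOfVal {f g : Shift G H} (α β : f ⟶ g) (h : H) : α ≅ β where
  hom := ofVal α β h
  inv := ofVal β α (-h)
  hom_inv_id := hom_ext (by simp)
  inv_hom_id := hom_ext (by simp)

@[simp] theorem val_inv {f g : Shift G H} {α β : f ⟶ g} (Γ : α ≅ β) :
    val Γ.inv = -val Γ.hom := by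
  rw [eq_neg_iff_add_eq_zero, ← val_comp, Γ.inv_hom_id, val_id]

/-- Since whiskering leaves values unchanged, the interchange law is commutativity of addition in
`H`; this is where `H` has to be abelian. Every other axiom compares values that differ only by
zeros. -/
instance bicategory : Bicategory.{u, u} (Shift G H) where
  homCategory := homCategory
  whiskerLeft _ _ _ Γ := ofVal _ _ (val Γ)
  whiskerRight Γ _ := ofVal _ _ (val Γ)
  associator _ _ _ := isoOfVal _ _ 0
  leftUnitor _ := isoOfVal _ _ 0
  rightUnitor _ := isoOfVal _ _ 0
  whiskerLeft_id _ _ := rfl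
  whiskerLeft_comp _ _ _ _ _ _ := rfl
  id_whiskerLeft _ := hom_ext (by simp)
  comp_whiskerLeft _ _ _ _ _ := hom_ext (by simp)
  id_whiskerRight _ _ := rfl
  comp_whiskerRight _ _ _ := rfl
  whiskerRight_id _ := hom_ext (by simp)
  whiskerRight_comp _ _ _ := hom_ext (by simp)
  whisker_assoc _ _ _ _ _ := hom_ext (by simp)
  whisker_exchange _ _ := hom_ext (add_comm _ _)
  pentagon _ _ _ _ := hom_ext (by simp)
  triangle _ _ := hom_ext (by simp)

@[simp] theorem val_whiskerLeft {f g h : Shift G H} (α : f ⟶ g) {β β' : g ⟶ h} (Γ : β ⟶ β') :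
    val (α ◁ Γ) = val Γ := rfl
@[simp] theorem val_whiskerRight {f g h : Shift G H} {α α' : f ⟶ g} (Γ : α ⟶ α') (β : g ⟶ h) :
    val (Γ ▷ β) = val Γ := rfl
@[simp] theorem val_associator {f g h k : Shift G H} (α : f ⟶ g) (β : g ⟶ h) (γ : h ⟶ k) :
    val (α_ α β γ).hom = 0 := rfl
@[simp] theorem val_leftUnitor {f g : Shift G H} (α : f ⟶ g) : val (λ_ α).hom = 0 := rfl
@[simp] theorem val_rightUnitor {f g : Shift G H} (α : f ⟶ g) : val (ρ_ α).hom = 0 := rfl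

/-! ### Trivial transformations between pseudofunctors into `Shift G H` -/

section Transformation

variable {C : Type u} [Bicategory.{u, u} C]

/-- Pseudofunctors into `Shift G H` with the same objects and the same values. -/
structure Agree (F F' : C ⥤ᵖ Shift G H) : Prop where
  obj : ∀ c, F.obj c = F'.obj c
  map₂ : ∀ {c d : C} {f g : c ⟶ d} (η : f ⟶ g), val (F.map₂ η) = val (F'.map₂ η)
  mapId : ∀ c, val (F.mapId c).hom = val (F'.mapId c).hom
  mapComp : ∀ {c d e : C} (f : c ⟶ d) (g : d ⟶ e),
    val (F.mapComp f g).hom = val (F'.mapComp f g).hom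

theorem Agree.symm {F F' : C ⥤ᵖ Shift G H} (h : Agree F F') : Agree F' F :=
  ⟨fun c => (h.obj c).symm, fun η => (h.map₂ η).symm, fun c => (h.mapId c).symm,
    fun f g => (h.mapComp f g).symm⟩

/-- The transformation with trivial components between pseudofunctors that agree. -/
def Agree.trans {F F' : C ⥤ᵖ Shift G H} (h : Agree F F') : F ⟶ F' where
  app c := ⟨h.obj c⟩
  naturality _ := isoOfVal _ _ 0
  naturality_naturality η := hom_ext (by simp [h.map₂])
  naturality_id c := hom_ext (by simp [h.mapId])
  naturality_comp f g := hom_ext (by simp [h.mapComp])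

/-- The equivalence with trivial components between pseudofunctors that agree. -/
def Agree.equivalence {F F' : C ⥤ᵖ Shift G H} (h : Agree F F') : F ≌ F' where
  hom := h.trans
  inv := h.symm.trans
  unit := Pseudofunctor.StrongTrans.isoMk (fun _ => isoOfVal _ _ 0) fun f => hom_ext (by
    -- Each summand is the value of one constraint or naturality cell in the modification square;
    -- `-0` is the value of an inverse cell.
    change (0 : H) + (-0 + (0 + (0 + (0 + -0)))) = 0 + -0 + 0
    simp)
  counit := Pseudofunctor.StrongTrans.isoMk (fun _ => isoOfVal _ _ 0) fun f => hom_ext (by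
    change (0 : H) + (0 + -0) = -0 + (0 + (0 + (0 + -0))) + 0
    simp)
  left_triangle := by
    ext c
    apply hom_ext
    simp [bicategoricalIsoComp]

end Transformation

end Shift

end Tricat

/-! ### The tricategory with one object, morphisms `G`, and 3-morphisms `H` -/

namespace Tricat

open TricatBase Shift

section Shift

variable (G H : Type u) [Group G] [AddCommGroup H] [DistribMulAction G H]

/-- Composition at a 0-cell: multiplication in `G` and in `G ⋉ H`. -/
def Shift.mul : Shift G H × Shift G H ⥤ᵖ Shift G H where
  obj p := ⟨p.1.pt * p.2.pt⟩
  map {p q} α := ⟨by rw [Hom₁.eq α.1, Hom₁.eq α.2]⟩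
  map₂ {p q α β} Γ := ofVal _ _ (val Γ.1 + p.1.pt • val Γ.2)
  mapId _ := isoOfVal _ _ 0
  mapComp _ _ := isoOfVal _ _ 0
  map₂_id _ := hom_ext (by simp)
  map₂_comp _ _ := hom_ext (by simp; abel)
  map₂_whisker_left α _ _ _ := hom_ext (by
    -- One side acts by the source of `α.1` and the other by its target. The 1-morphism `α.1` is an
    -- equality between the two.
    simp [show _ = _ from Hom₁.eq α.1])
  map₂_whisker_right α _ := hom_ext (by simp)
  map₂_associator _ _ _ := hom_ext (by simp)
  map₂_left_unitor _ := hom_ext (by simp)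
  map₂_right_unitor _ := hom_ext (by simp)

/-- The bicategory `Shift G H` with the composition of `G ⋉ H`. -/
def shiftBase : TricatBase PUnit.{u + 1} where
  Hom _ _ := Shift G H
  one _ := ⟨1⟩
  comp _ _ _ := Shift.mul G H

/-- Associativity of `G ⋉ H`: both bracketings of three 3-morphisms over `a`, `b`, `c` have the
value `h + a h' + ab h''`. The objects `(ab)c` and `a(bc)` are equal but not identical, so the
associator is a transformation between agreeing pseudofunctors and not an identity. -/
theorem shiftBase_assoc (x y z w : PUnit.{u + 1}) :
    Agree (C := (Shift G H × Shift G H) × Shift G H) (G := G) (H := H)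
      ((shiftBase G H).assocSrc x y z w) ((shiftBase G H).assocTgt x y z w) where
  obj p := congrArg Shift.mk (mul_assoc _ _ _)
  map₂ {p q f g} η := by
    obtain ⟨⟨a, b⟩, c⟩ := p
    change val η.1.1 + a.pt • val η.1.2 + (a.pt * b.pt) • val η.2 =
      val η.1.1 + a.pt • (val η.1.2 + b.pt • val η.2)
    rw [smul_add, mul_smul, add_assoc]
  mapId p := by
    obtain ⟨⟨a, b⟩, c⟩ := p
    change (0 + a.pt • (0 : H) + 0) + (a.pt * b.pt) • (0 : H) + 0 =
      (0 + 0) + a.pt • (((0 + 0) + b.pt • (0 : H)) + 0) + 0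
    simp
  mapComp {p q r} α β := by
    obtain ⟨⟨a, b⟩, c⟩ := p
    change (0 + a.pt • (0 : H) + 0) + (a.pt * b.pt) • (0 : H) + 0 =
      (0 + 0) + a.pt • (((0 + 0) + b.pt • (0 : H)) + 0) + 0
    simp

theorem shiftBase_left (x y : PUnit.{u + 1}) :
    Agree (C := Shift G H) (G := G) (H := H) ((shiftBase G H).leftSrc x y)
      (Pseudofunctor.id _) where
  obj p := congrArg Shift.mk (one_mul _)
  map₂ {p q f g} η := by
    change (0 : H) + (1 : G) • val η = val η
    simp
  mapId p := by
    change (0 : H) + (1 : G) • (0 : H) + 0 = 0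
    simp
  mapComp {p q r} α β := by
    -- The summand `-0` is the inverse constraint by which the constant factor `𝟙` is identified
    -- with `𝟙 ≫ 𝟙`.
    change (-0 : H) + (1 : G) • (0 : H) + 0 = 0
    simp

theorem shiftBase_right (x y : PUnit.{u + 1}) :
    Agree (C := Shift G H) (G := G) (H := H) ((shiftBase G H).rightSrc x y)
      (Pseudofunctor.id _) where
  obj p := congrArg Shift.mk (mul_one _)
  map₂ {p q f g} η := by
    change val η + p.pt • (0 : H) = val η
    simp
  mapId p := by
    change (0 : H) + p.pt • (0 : H) + 0 = 0
    simp
  mapComp {p q r} α β := by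
    change (0 : H) + p.pt • (-0 : H) + 0 = 0
    simp

/-- The associator and the unitors are trivial. -/
def shiftUnits : TricatUnits PUnit.{u + 1} where
  toTricatBase := shiftBase G H
  assoc x y z w := (shiftBase_assoc G H x y z w).equivalence
  left x y := (shiftBase_left G H x y).equivalence
  right x y := (shiftBase_right G H x y).equivalence

variable {G H}

/-- The pentagonator is given by `c`, the triangulators are trivial. -/
def shiftCells (c : G → G → G → G → H) : TricatCells PUnit.{u + 1} where
  toTricatUnits := shiftUnits G H
  pi f g h k := isoOfVal (G := G) (H := H) _ _ (c (pt f) (pt g) (pt h) (pt k))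
  lam _ _ := isoOfVal (G := G) (H := H) _ _ 0
  mu _ _ := isoOfVal (G := G) (H := H) _ _ 0
  rho _ _ := isoOfVal (G := G) (H := H) _ _ 0

end Shift

/-- A value in `H` of all 3-morphisms, additive for the compositions at 2-cells and 1-cells and
twisted by the value of morphisms in `G` for the composition at 0-cells, such that all
constraint cells other than the pentagonator have value zero. -/
structure TricatValue {Ob : Type u} (T : TricatCells Ob) (G H : Type u) [Group G] [AddCommGroup H]
    [DistribMulAction G H] where
  pt : ∀ {x y : Ob}, T.Hom x y → G
  val : ∀ {x y : Ob} {f g : T.Hom x y} {α β : f ⟶ g}, (α ⟶ β) → H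
  c : G → G → G → G → H
  pt_o : ∀ {x y z : Ob} (f : T.Hom x y) (g : T.Hom y z), pt (o f g) = pt f * pt g
  pt_one : ∀ x : Ob, pt (T.one x) = 1
  id : ∀ {x y : Ob} {f g : T.Hom x y} (α : f ⟶ g), val (𝟙 α) = 0
  comp : ∀ {x y : Ob} {f g : T.Hom x y} {α β γ : f ⟶ g} (Γ : α ⟶ β) (Γ' : β ⟶ γ),
    val (Γ ≫ Γ') = val Γ + val Γ'
  whiskerLeft : ∀ {x y : Ob} {f g h : T.Hom x y} (α : f ⟶ g) {β β' : g ⟶ h} (Γ : β ⟶ β'),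
    val (α ◁ Γ) = val Γ
  whiskerRight : ∀ {x y : Ob} {f g h : T.Hom x y} {α α' : f ⟶ g} (Γ : α ⟶ α') (β : g ⟶ h),
    val (Γ ▷ β) = val Γ
  associator : ∀ {x y : Ob} {f g h k : T.Hom x y} (α : f ⟶ g) (β : g ⟶ h) (γ : h ⟶ k),
    val (α_ α β γ).hom = 0
  leftUnitor : ∀ {x y : Ob} {f g : T.Hom x y} (α : f ⟶ g), val (λ_ α).hom = 0
  rightUnitor : ∀ {x y : Ob} {f g : T.Hom x y} (α : f ⟶ g), val (ρ_ α).hom = 0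
  o₃ : ∀ {x y z : Ob} {f f' : T.Hom x y} {g g' : T.Hom y z} {α α' : f ⟶ f'} {β β' : g ⟶ g'}
    (Γ : α ⟶ α') (Γ' : β ⟶ β'), val (o₃ Γ Γ') = val Γ + pt f • val Γ'
  oId : ∀ {x y z : Ob} (f : T.Hom x y) (g : T.Hom y z), val (oId f g).hom = 0
  oComp : ∀ {x y z : Ob} {f f' f'' : T.Hom x y} {g g' g'' : T.Hom y z} (α : f ⟶ f')
    (α' : f' ⟶ f'') (β : g ⟶ g') (β' : g' ⟶ g''), val (oComp α α' β β').hom = 0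
  aUnit : ∀ {x y z w : Ob} (f : T.Hom x y) (g : T.Hom y z) (h : T.Hom z w),
    val (T.aUnit f g h).hom = 0
  aCounit : ∀ {x y z w : Ob} (f : T.Hom x y) (g : T.Hom y z) (h : T.Hom z w),
    val (T.aCounit f g h).hom = 0
  aNat : ∀ {x y z w : Ob} {f f' : T.Hom x y} {g g' : T.Hom y z} {h h' : T.Hom z w} (α : f ⟶ f')
    (β : g ⟶ g') (γ : h ⟶ h'), val (T.aNat α β γ).hom = 0
  aNat' : ∀ {x y z w : Ob} {f f' : T.Hom x y} {g g' : T.Hom y z} {h h' : T.Hom z w} (α : f ⟶ f')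
    (β : g ⟶ g') (γ : h ⟶ h'), val (T.aNat' α β γ).hom = 0
  lUnit : ∀ {x y : Ob} (f : T.Hom x y), val (T.lUnit f).hom = 0
  lCounit : ∀ {x y : Ob} (f : T.Hom x y), val (T.lCounit f).hom = 0
  lNat : ∀ {x y : Ob} {f f' : T.Hom x y} (α : f ⟶ f'), val (T.lNat α).hom = 0
  lNat' : ∀ {x y : Ob} {f f' : T.Hom x y} (α : f ⟶ f'), val (T.lNat' α).hom = 0
  rUnit : ∀ {x y : Ob} (f : T.Hom x y), val (T.rUnit f).hom = 0
  rCounit : ∀ {x y : Ob} (f : T.Hom x y), val (T.rCounit f).hom = 0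
  rNat : ∀ {x y : Ob} {f f' : T.Hom x y} (α : f ⟶ f'), val (T.rNat α).hom = 0
  rNat' : ∀ {x y : Ob} {f f' : T.Hom x y} (α : f ⟶ f'), val (T.rNat' α).hom = 0
  lam : ∀ {x y z : Ob} (f : T.Hom x y) (g : T.Hom y z), val (T.lam f g).hom = 0
  mu : ∀ {x y z : Ob} (f : T.Hom x y) (g : T.Hom y z), val (T.mu f g).hom = 0
  rho : ∀ {x y z : Ob} (f : T.Hom x y) (g : T.Hom y z), val (T.rho f g).hom = 0
  pi : ∀ {x y z w v : Ob} (f : T.Hom x y) (g : T.Hom y z) (h : T.Hom z w) (k : T.Hom w v),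
    val (T.pi f g h k).hom = c (pt f) (pt g) (pt h) (pt k)

/-! ### Values in `H` of pastings -/

namespace TricatValue

variable {Ob : Type u} {T : TricatCells Ob} {G H : Type u} [Group G] [AddCommGroup H]
  [DistribMulAction G H] (V : TricatValue T G H) {x y z w v t : Ob}

attribute [simp] pt_o pt_one id comp whiskerLeft whiskerRight associator leftUnitor rightUnitor o₃
  oId oComp aUnit aCounit aNat aNat' lUnit lCounit lNat lNat' rUnit rCounit rNat rNat' lam mu rho pi

@[simp]
theorem inv {f g : T.Hom x y} {α β : f ⟶ g} (Γ : α ≅ β) : V.val Γ.inv = -V.val Γ.hom := by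
  rw [eq_neg_iff_add_eq_zero, ← V.comp, Γ.inv_hom_id, V.id]

@[simp]
-- The rule `o₃` for a pair that is not syntactically a tuple, the shape in which `oIso` presents
-- its components.
theorem map₂_comp {p q : T.Hom x y × T.Hom y z} {α β : p ⟶ q} (Γ : α ⟶ β) :
    V.val ((T.comp x y z).map₂ Γ) = V.val Γ.1 + V.pt p.1 • V.val Γ.2 := V.o₃ Γ.1 Γ.2

@[simp]
theorem distR {f f' f'' : T.Hom x y} (α : f ⟶ f') (α' : f' ⟶ f'') (g : T.Hom y z) :
    V.val (distR α α' g).hom = 0 := by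
  simp [TricatBase.distR]

@[simp]
theorem distL (f : T.Hom x y) {g g' g'' : T.Hom y z} (β : g ⟶ g') (β' : g' ⟶ g'') :
    V.val (distL f β β').hom = 0 := by
  simp [TricatBase.distL]

@[simp]
theorem sqComp {a b c a' b' c' : T.Hom x y} {p : a ⟶ b} {q : b ⟶ c} {p' : a' ⟶ b'} {q' : b' ⟶ c'}
    {u : a ⟶ a'} {v : b ⟶ b'} {w : c ⟶ c'} (σ : u ≫ p' ≅ p ≫ v) (τ : v ≫ q' ≅ q ≫ w) :
    V.val (sqComp σ τ).hom = V.val σ.hom + V.val τ.hom := by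
  simp [Tricat.sqComp]

@[simp]
theorem sqId {a a' : T.Hom x y} (u : a ⟶ a') : V.val (sqId u).hom = 0 := by
  simp [Tricat.sqId]

@[simp]
theorem sqO {f₁ f₂ f₃ f₄ : T.Hom x y} {g₁ g₂ g₃ g₄ : T.Hom y z} {p : f₁ ⟶ f₂} {p' : f₃ ⟶ f₄}
    {u : f₁ ⟶ f₃} {v : f₂ ⟶ f₄} {q : g₁ ⟶ g₂} {q' : g₃ ⟶ g₄} {s : g₁ ⟶ g₃} {t : g₂ ⟶ g₄}
    (σ : u ≫ p' ≅ p ≫ v) (τ : s ≫ q' ≅ q ≫ t) :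
    V.val (sqO σ τ).hom = V.val σ.hom + V.pt f₁ • V.val τ.hom := by
  simp [TricatBase.sqO]

@[simp]
-- Passing to inverses reverses direction, so `σ` enters with a minus sign; with trivial `i` and `j`
-- a mate has the negative value.
theorem mateIso {a b : T.Hom x y} {p q : a ⟶ b} {p' q' : b ⟶ a} (i : p ≫ p' ≅ 𝟙 a)
    (j : 𝟙 b ≅ q' ≫ q) (σ : p ≅ q) :
    V.val (mateIso i j σ).hom = V.val j.hom - V.val σ.hom + V.val i.hom := by
  simp [Tricat.mateIso]
  abel

@[simp]
theorem cancelRight {a b c : T.Hom x y} {p q : a ⟶ b} {e : b ⟶ c} {e' : c ⟶ b} (i : e ≫ e' ≅ 𝟙 b)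
    (σ : p ≫ e ≅ q ≫ e) : V.val (cancelRight i σ).hom = V.val σ.hom := by
  simp [Tricat.cancelRight]

@[simp]
theorem cancelLeft {a b c : T.Hom x y} {p q : b ⟶ c} {e : a ⟶ b} {e' : b ⟶ a} (j : e' ≫ e ≅ 𝟙 b)
    (σ : e ≫ p ≅ e ≫ q) : V.val (cancelLeft j σ).hom = V.val σ.hom := by
  simp [Tricat.cancelLeft]

@[simp]
theorem piR (f : T.Hom x y) (g : T.Hom y z) (h : T.Hom z w) (k : T.Hom w v) (p : T.Hom v t) :
    V.val (T.piR f g h k p).hom = V.c (V.pt f) (V.pt g) (V.pt h) (V.pt k) := by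
  simp [TricatCells.piR]

@[simp]
theorem piL (e : T.Hom t x) (f : T.Hom x y) (g : T.Hom y z) (h : T.Hom z w) (k : T.Hom w v) :
    V.val (T.piL e f g h k).hom = V.pt e • V.c (V.pt f) (V.pt g) (V.pt h) (V.pt k) := by
  simp [TricatCells.piL]

/-- The middle term is kept because the coherence cell depends on the instance. In each concrete
pasting it is built from identities, whiskerings, associators and unitors, and `simp` then evaluates
it to zero. -/
theorem bicategoricalComp {a b : T.Hom x y} {f g h k : a ⟶ b} [BicategoricalCoherence g h]
    (η : f ⟶ g) (θ : h ⟶ k) :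
    V.val (η ⊗≫ θ) = V.val η + V.val (BicategoricalCoherence.iso : g ≅ h).hom + V.val θ := by
  simp [CategoryTheory.bicategoricalComp, add_assoc]

/-- No action of `G` appears: the pentagonator occurs twice whiskered at 1-cells, and once as the
left factor `π · 1` at a 0-cell. -/
theorem pentFst (f : T.Hom x y) (g : T.Hom y z) (h : T.Hom z w) (k : T.Hom w v) (p : T.Hom v t) :
    V.val (T.pentFst f g h k p) = V.c (V.pt f) (V.pt g) (V.pt h) (V.pt k) +
      V.c (V.pt f) (V.pt g) (V.pt h * V.pt k) (V.pt p) +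
      V.c (V.pt f * V.pt g) (V.pt h) (V.pt k) (V.pt p) := by
  simp [TricatCells.pentFst, V.bicategoricalComp, add_assoc]

/-- The cell `1 · π` has the pentagonator as its right factor at a 0-cell; it produces the only
summand twisted by the action. -/
theorem pentSnd (f : T.Hom x y) (g : T.Hom y z) (h : T.Hom z w) (k : T.Hom w v) (p : T.Hom v t) :
    V.val (T.pentSnd f g h k p) = V.pt f • V.c (V.pt g) (V.pt h) (V.pt k) (V.pt p) +
      V.c (V.pt f) (V.pt g * V.pt h) (V.pt k) (V.pt p) +
      V.c (V.pt f) (V.pt g) (V.pt h) (V.pt k * V.pt p) := by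
  simp [TricatCells.pentSnd, V.bicategoricalComp, add_assoc]

/-- The pentagonator occurs once, with a unit as second argument. The opposite pasting contains only
cells of value zero, so the axiom amounts to normalization in this argument. The right normalization
axiom does the same for the third argument. -/
theorem leftNormFst (f : T.Hom x y) (g : T.Hom y z) (h : T.Hom z w) :
    V.val (T.leftNormFst f g h) = V.c (V.pt f) 1 (V.pt g) (V.pt h) := by
  simp [TricatCells.leftNormFst, V.bicategoricalComp]

theorem leftNormSnd (f : T.Hom x y) (g : T.Hom y z) (h : T.Hom z w) :
    V.val (T.leftNormSnd f g h) = 0 := by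
  simp [TricatCells.leftNormSnd]

theorem rightNormFst (f : T.Hom x y) (g : T.Hom y z) (h : T.Hom z w) :
    V.val (T.rightNormFst f g h) = V.c (V.pt f) (V.pt g) 1 (V.pt h) := by
  simp [TricatCells.rightNormFst, V.bicategoricalComp]

theorem rightNormSnd (f : T.Hom x y) (g : T.Hom y z) (h : T.Hom z w) :
    V.val (T.rightNormSnd f g h) = 0 := by
  simp [TricatCells.rightNormSnd, V.bicategoricalComp]

@[simp]
theorem lrOne (x : Ob) : V.val (T.lrOne x).hom = 0 := by
  simp [TricatCells.lrOne]

@[simp]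
theorem lrOne' (x : Ob) : V.val (T.lrOne' x).hom = 0 := by
  simp [TricatCells.lrOne']

@[simp]
theorem lam₁ (f : T.Hom x y) (g : T.Hom y z) : V.val (T.lam₁ f g).hom = 0 := by
  simp [TricatCells.lam₁]

@[simp]
-- This mate is the pentagonator itself, not its inverse, pasted with a unit and a counit of the
-- associator, which have value zero.
theorem pi₁ (f : T.Hom x y) (g : T.Hom y z) (h : T.Hom z w) (k : T.Hom w v) :
    V.val (T.pi₁ f g h k) = V.c (V.pt f) (V.pt g) (V.pt h) (V.pt k) := by
  simp [TricatCells.pi₁, V.bicategoricalComp]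

@[simp]
theorem rho₁ (f : T.Hom x y) (g : T.Hom y z) : V.val (T.rho₁ f g) = 0 := by
  simp [TricatCells.rho₁, V.bicategoricalComp]

@[simp]
theorem etaInterchange (f : T.Hom x y) (f' : T.Hom y x) (n : T.one x ⟶ o f f') :
    V.val (T.etaInterchange f f' n).hom = 0 := by
  simp [TricatCells.etaInterchange]

/-- Only three cells of the pasting can have a nonzero value: `Φ · 1`, the mate of the pentagonator,
and the inverse of `1 · Θ`, where `f` acts from the left. The value of `e` or `n` does not arise, as
these are 2-morphisms. -/
theorem swallowtail (f : T.Hom x y) (f' : T.Hom y x) (e : o f' f ⟶ T.one y) (n : T.one x ⟶ o f f')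
    (Φ : 𝟙 f ≅ T.zigzag f f' e n) (Θ : 𝟙 f' ≅ T.zagzig f f' e n) :
    V.val (T.swallowtail f f' e n Φ Θ) = V.val Φ.hom +
      V.c (V.pt f) (V.pt f') (V.pt f) (V.pt f') - V.pt f • V.val Θ.hom := by
  simp [TricatCells.swallowtail, V.bicategoricalComp, sub_eq_add_neg, add_assoc]

end TricatValue
end Tricat

/-! ### The tricategory of a cocycle and its inverses -/

namespace Tricat

open TricatBase Shift

variable {G H : Type u} [Group G] [AddCommGroup H] [DistribMulAction G H]

/-- The value of the 3-morphisms of `shiftCells c`. -/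
def shiftValue (c : G → G → G → G → H) : TricatValue (shiftCells c) G H where
  pt f := Shift.pt f
  val Γ := Shift.val (G := G) (H := H) Γ
  c := c
  pt_o _ _ := rfl
  pt_one _ := rfl
  id _ := rfl
  comp _ _ := rfl
  whiskerLeft _ _ _ _ := rfl
  whiskerRight _ _ := rfl
  associator _ _ _ := rfl
  leftUnitor _ := rfl
  rightUnitor _ := rfl
  o₃ _ _ := rfl
  oId _ _ := rfl
  oComp _ _ _ _ := rfl
  aUnit _ _ _ := rfl
  aCounit _ _ _ := rfl
  aNat _ _ _ := rfl
  aNat' _ _ _ := rfl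
  lUnit _ := rfl
  lCounit _ := rfl
  lNat _ := rfl
  lNat' _ := rfl
  rUnit _ := rfl
  rCounit _ := rfl
  rNat _ := rfl
  rNat' _ := rfl
  lam _ _ := rfl
  mu _ _ := rfl
  rho _ _ := rfl
  pi _ _ _ _ := rfl

/-- Faithfulness of the value in the model: it turns each axiom on 3-morphisms into an equation in
`H`. -/
theorem shiftCells_hom_ext {c : G → G → G → G → H} {x y : PUnit.{u + 1}}
    {f g : (shiftCells c).Hom x y} {α β : f ⟶ g} {Γ Γ' : α ⟶ β}
    (h : (shiftValue c).val Γ = (shiftValue c).val Γ') : Γ = Γ' :=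
  Shift.hom_ext (G := G) (H := H) h

/-- The cocycle condition for functions on a group. -/
def IsCocycle₄ (c : G → G → G → G → H) : Prop :=
  ∀ g₁ g₂ g₃ g₄ g₅ : G, g₁ • c g₂ g₃ g₄ g₅ - c (g₁ * g₂) g₃ g₄ g₅ + c g₁ (g₂ * g₃) g₄ g₅ -
    c g₁ g₂ (g₃ * g₄) g₅ + c g₁ g₂ g₃ (g₄ * g₅) - c g₁ g₂ g₃ g₄ = 0

/-- The differential of `c` is the value of the second pasting minus that of the first. No
faithfulness is assumed, so the equivalence applies to the model and to any given brane. -/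
theorem TricatValue.pentagonator_iff {Ob : Type u} {T : TricatCells Ob} (V : TricatValue T G H)
    {x y z w v t : Ob} (f : T.Hom x y) (g : T.Hom y z) (h : T.Hom z w) (k : T.Hom w v)
    (p : T.Hom v t) :
    V.val (T.pentFst f g h k p) = V.val (T.pentSnd f g h k p) ↔
      V.pt f • V.c (V.pt g) (V.pt h) (V.pt k) (V.pt p) -
        V.c (V.pt f * V.pt g) (V.pt h) (V.pt k) (V.pt p) +
        V.c (V.pt f) (V.pt g * V.pt h) (V.pt k) (V.pt p) -
        V.c (V.pt f) (V.pt g) (V.pt h * V.pt k) (V.pt p) +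
        V.c (V.pt f) (V.pt g) (V.pt h) (V.pt k * V.pt p) -
        V.c (V.pt f) (V.pt g) (V.pt h) (V.pt k) = 0 := by
  rw [V.pentFst, V.pentSnd, eq_comm, ← sub_eq_zero]
  refine Eq.congr ?_ rfl
  abel

/-- The tricategory given by a normalized cocycle. -/
def shiftTricategory (c : G → G → G → G → H) (hc : IsCocycle₄ c)
    (h₂ : ∀ f g h, c f 1 g h = 0) (h₃ : ∀ f g h, c f g 1 h = 0) : Tricategory PUnit.{u + 1} where
  toTricatCells := shiftCells c
  pi_mod {_ _ _ _ _} {f f' g g' h h' k k'} α β γ δ := shiftCells_hom_ext (by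
    -- The two sides evaluate to `c` at the targets and at the sources of the 2-morphisms, and these
    -- agree.
    obtain rfl : f = f' := Hom₁.eq α
    obtain rfl : g = g' := Hom₁.eq β
    obtain rfl : h = h' := Hom₁.eq γ
    obtain rfl : k = k' := Hom₁.eq δ
    simp)
  lam_mod _ _ := shiftCells_hom_ext (by simp)
  mu_mod _ _ := shiftCells_hom_ext (by simp)
  rho_mod _ _ := shiftCells_hom_ext (by simp)
  pentagonator _ _ _ _ _ := shiftCells_hom_ext (by
    rw [TricatValue.pentagonator_iff]
    exact hc _ _ _ _ _)
  left_norm _ _ _ := shiftCells_hom_ext (by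
    rw [TricatValue.leftNormFst, TricatValue.leftNormSnd]
    exact h₂ _ _ _)
  right_norm _ _ _ := shiftCells_hom_ext (by
    rw [TricatValue.rightNormFst, TricatValue.rightNormSnd]
    exact h₃ _ _ _)

/-- The equivalence with trivial constraints given by an equality of objects. -/
def Shift.equivalence {f g : Shift G H} (h : f = g) : f ≌ g where
  hom := ⟨h⟩
  inv := ⟨h.symm⟩
  unit := isoOfVal _ _ 0
  counit := isoOfVal _ _ 0
  left_triangle := Iso.ext (Shift.hom_ext (by simp [bicategoricalComp]; rfl))

/-- The inverses in the tricategory given by a normalized cocycle. -/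
def shiftInverses (c : G → G → G → G → H) (hc : IsCocycle₄ c)
    (h₂ : ∀ f g h, c f 1 g h = 0) (h₃ : ∀ f g h, c f g 1 h = 0) :
    TricatInverses (shiftTricategory c hc h₂ h₃) where
  inv₃ Γ := ofVal (G := G) (H := H) _ _ (-Shift.val (G := G) (H := H) Γ)
  comp_inv₃ Γ := Shift.hom_ext (G := G) (H := H) (add_neg_cancel _)
  inv₃_comp Γ := Shift.hom_ext (G := G) (H := H) (neg_add_cancel _)
  inv₂ α := (Shift.equivalence (G := G) (H := H) (Hom₁.eq α)).inv
  counit₂ α := (Shift.equivalence (G := G) (H := H) (Hom₁.eq α)).counit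
  unit₂ α := (Shift.equivalence (G := G) (H := H) (Hom₁.eq α)).unit
  left_zigzag₂ α := (Shift.equivalence (G := G) (H := H) (Hom₁.eq α)).left_triangle_hom
  -- An equivalence stores one triangle identity; the other is a consequence.
  right_zigzag₂ α := (Shift.equivalence (G := G) (H := H) (Hom₁.eq α)).right_triangle_hom
  inv₁ f := ⟨(Shift.pt f)⁻¹⟩
  eps f := Shift.equivalence (congrArg Shift.mk (inv_mul_cancel (Shift.pt f)))
  eta f := Shift.equivalence (congrArg Shift.mk (mul_inv_cancel (Shift.pt f)).symm)
  -- With `Θ` trivial, the swallowtail identity forces this value.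
  Phi f := isoOfVal (G := G) (H := H) _ _
    (-c (Shift.pt f) (Shift.pt f)⁻¹ (Shift.pt f) (Shift.pt f)⁻¹)
  Theta f := isoOfVal (G := G) (H := H) _ _ 0
  swallowtail f := shiftCells_hom_ext (by
    refine ((shiftValue c).swallowtail _ _ _ _ _ _).trans (Eq.trans ?_ ((shiftValue c).id _).symm)
    change -c (Shift.pt f) (Shift.pt f)⁻¹ (Shift.pt f) (Shift.pt f)⁻¹ +
      c (Shift.pt f) (Shift.pt f)⁻¹ (Shift.pt f) (Shift.pt f)⁻¹ - Shift.pt f • (0 : H) = 0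
    simp)

end Tricat

/-! ### The cartesian category of supermanifolds -/

namespace SuperGeometry

namespace VPts

variable {ι κ ι' κ' ι'' κ'' : Type} [Fintype ι] [Fintype κ] [Fintype ι'] [Fintype κ'] [Fintype ι'']
  [Fintype κ'']

/-- `A₀`-smoothness at a point. -/
def SmoothAt {n : ℕ} (φ : VPts ι κ n → VPts ι' κ' n) (x : VPts ι κ n) : Prop :=
  ContDiffAt ℝ ∞ φ x ∧ ∃ D : VPts ι κ n →L[ℝ] VPts ι' κ' n,
    HasFDerivAt φ D x ∧ ∀ (a : Gr.part n 0) (v : VPts ι κ n), D (evenSMul a v) = evenSMul a (D v)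

/-- Smoothness becomes a local condition, which allows a different intermediate chart at each point
when maps are composed. -/
theorem smoothOn_iff {n : ℕ} {φ : VPts ι κ n → VPts ι' κ' n} {s : Set (VPts ι κ n)}
    (hs : IsOpen s) : SmoothOn φ s ↔ ∀ x ∈ s, SmoothAt φ x :=
  ⟨fun h x hx => ⟨h.1.contDiffAt (hs.mem_nhds hx), h.2 x hx⟩,
    fun h => ⟨fun x hx => (h x hx).1.contDiffWithinAt, fun x hx => (h x hx).2⟩⟩

theorem SmoothAt.comp {n : ℕ} {φ : VPts ι κ n → VPts ι' κ' n} {ψ : VPts ι' κ' n → VPts ι'' κ'' n}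
    {x : VPts ι κ n} (hψ : SmoothAt ψ (φ x)) (hφ : SmoothAt φ x) : SmoothAt (ψ ∘ φ) x := by
  obtain ⟨hψ, E, hE, hEa⟩ := hψ
  obtain ⟨hφ, D, hD, hDa⟩ := hφ
  exact ⟨hψ.comp x hφ, E.comp D, hE.comp x hD, fun a v => by
    simp only [ContinuousLinearMap.comp_apply, hDa, hEa]⟩

theorem SmoothAt.congr {n : ℕ} {φ ψ : VPts ι κ n → VPts ι' κ' n} {x : VPts ι κ n}
    (hφ : SmoothAt φ x) (h : ψ =ᶠ[nhds x] φ) : SmoothAt ψ x := by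
  obtain ⟨hφ, D, hD, hDa⟩ := hφ
  exact ⟨hφ.congr_of_eventuallyEq h, D, hD.congr_of_eventuallyEq h, hDa⟩

theorem SmoothAt.prodMk {n : ℕ} {φ : VPts ι κ n → VPts ι' κ' n} {ψ : VPts ι κ n → VPts ι'' κ'' n}
    {x : VPts ι κ n} (hφ : SmoothAt φ x) (hψ : SmoothAt ψ x) :
    SmoothAt (fun v => prodEquiv ι' κ' ι'' κ'' n (φ v, ψ v)) x := by
  obtain ⟨hφ, D, hD, hDa⟩ := hφ
  obtain ⟨hψ, E, hE, hEa⟩ := hψ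
  let e : VPts ι' κ' n × VPts ι'' κ'' n →L[ℝ] VPts (ι' ⊕ ι'') (κ' ⊕ κ'') n :=
    (prodEquiv ι' κ' ι'' κ'' n).toContinuousLinearMap
  refine ⟨(prodEquiv ι' κ' ι'' κ'' n).contDiff.contDiffAt.comp x (hφ.prodMk hψ), e.comp (D.prod E),
    e.hasFDerivAt.comp x (hD.prodMk hE), fun a v => ?_⟩
  change prodEquiv ι' κ' ι'' κ'' n (D _, E _) = _
  rw [hDa, hEa, prodEquiv_evenSMul]
  rfl

end VPts

open VPts

namespace SMap

variable {M N K L : SuperManifold.{u}}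

/-- This makes the pointwise criterion `smoothOn_iff` applicable. It is stated for continuous
families because it is needed before a composite or a pairing is known to be smooth. -/
theorem isOpen_chart_domain {f : ∀ n, M.pts n → N.pts n} (hf : ∀ n, Continuous (f n))
    (a : M.Idx) (b : N.Idx) (n : ℕ) :
    IsOpen ((M.chart a n).target ∩ {v | f n ((M.chart a n).symm v) ∈ (N.chart b n).source}) :=
  ((hf n).comp_continuousOn (M.chart a n).continuousOn_symm).isOpen_inter_preimage
    (M.chart a n).open_target (N.chart b n).open_source

theorem smoothAt (φ : SMap M N) (a : M.Idx) (b : N.Idx) (n : ℕ) {v : VPts M.ev M.od n}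
    (hv : v ∈ (M.chart a n).target) (hv' : φ n ((M.chart a n).symm v) ∈ (N.chart b n).source) :
    SmoothAt (fun v => N.chart b n (φ n ((M.chart a n).symm v))) v :=
  (smoothOn_iff (isOpen_chart_domain φ.cont a b n)).1 (φ.smooth a b n) v ⟨hv, hv'⟩

/-- Composition of maps of supermanifolds. -/
def comp (ψ : SMap N K) (φ : SMap M N) : SMap M K where
  toFun n x := ψ n (φ n x)
  naturality f x := by rw [φ.naturality, ψ.naturality]
  cont n := (ψ.cont n).comp (φ.cont n)
  smooth a c n := by
    refine (smoothOn_iff (isOpen_chart_domain (f := fun n x => ψ n (φ n x))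
      (fun n => (ψ.cont n).comp (φ.cont n)) a c n)).2 fun v hv => ?_
    -- A chart of `N` around the image point is inserted between the two maps. It cancels wherever
    -- `φ` lands in its source, which is a neighbourhood of `v`.
    obtain ⟨b, hb⟩ := N.chart_cover n (φ n ((M.chart a n).symm v))
    have hψ := ψ.smoothAt b c n (v := N.chart b n (φ n ((M.chart a n).symm v)))
      ((N.chart b n).map_source hb) (by rw [(N.chart b n).left_inv hb]; exact hv.2)
    refine (hψ.comp (φ.smoothAt a b n hv.1 hb)).congr ?_
    filter_upwards [(isOpen_chart_domain φ.cont a b n).mem_nhds ⟨hv.1, hb⟩] with w hw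
    simp only [Function.comp_apply]
    rw [(N.chart b n).left_inv hw.2]

/-- The pairing of two maps of supermanifolds. -/
def pair (φ : SMap M N) (ψ : SMap M K) : SMap M (N.prod K) where
  toFun n x := (φ n x, ψ n x)
  naturality f x := Prod.ext (φ.naturality f x) (ψ.naturality f x)
  cont n := (φ.cont n).prodMk (ψ.cont n)
  smooth a b n := by
    refine (smoothOn_iff (isOpen_chart_domain (N := N.prod K) (f := fun n x => (φ n x, ψ n x))
      (fun n => (φ.cont n).prodMk (ψ.cont n)) a b n)).2 fun v hv => ?_
    exact (φ.smoothAt a b.1 n hv.1 hv.2.1).prodMk (ψ.smoothAt a b.2 n hv.1 hv.2.2)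

/-- The second projection. -/
def snd (M N : SuperManifold.{u}) : SMap (M.prod N) N where
  toFun _ x := x.2
  naturality _ _ := rfl
  cont _ := continuous_snd
  smooth a b n := by
    have h := N.transition_smooth a.2 b n
    rw [OpenPartialHomeomorph.trans_source] at h
    let e : VPts (M.ev ⊕ N.ev) (M.od ⊕ N.od) n →L[ℝ] VPts N.ev N.od n :=
      (ContinuousLinearMap.snd ℝ _ _).comp
        (VPts.prodEquiv M.ev M.od N.ev N.od n).symm.toContinuousLinearMap
    refine ⟨h.1.comp e.contDiff.contDiffOn (fun v hv => ⟨hv.1.2, hv.2⟩), fun x hx => ?_⟩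
    obtain ⟨D, hD, hDa⟩ := h.2 (e x) ⟨hx.1.2, hx.2⟩
    exact ⟨D.comp e, hD.comp x e.hasFDerivAt, fun a v => hDa a (e v)⟩

@[simp] theorem comp_apply (ψ : SMap N K) (φ : SMap M N) (n : ℕ) (x : M.pts n) :
    ψ.comp φ n x = ψ n (φ n x) := rfl
@[simp] theorem id_apply (n : ℕ) (x : M.pts n) : SMap.id M n x = x := rfl

end SMap

/-- An operation defined on a retract of `X` and given there by a map of supermanifolds. -/
theorem IsSmoothOp.of_retract {X M P : SuperManifold.{u}} {R : ∀ n, X.pts n → M.pts n → Prop}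
    (ι : SMap P X) (r : SMap X P) (φ : SMap P M) (hr : ∀ n p, r n (ι n p) = p)
    (hR : ∀ n p q, R n p q ↔ ∃ p', ι n p' = p ∧ φ n p' = q) : IsSmoothOp X M R := by
  -- A map `ψ` with values in the domain takes values in the image of `ι`, where `ι ∘ r` is the
  -- identity, so `r ∘ ψ` is the required factorization.
  refine ⟨P, ι, φ, fun n => Function.LeftInverse.injective (hr n), hR, fun Y ψ h =>
    ⟨r.comp ψ, fun n y => ?_⟩⟩
  obtain ⟨q, hq⟩ := h n y
  obtain ⟨p', hp', -⟩ := (hR n _ q).1 hq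
  rw [SMap.comp_apply, ← hp', hr]

/-- An everywhere defined operation given by a map of supermanifolds. -/
theorem IsSmoothOp.of_total {X M : SuperManifold.{u}} {R : ∀ n, X.pts n → M.pts n → Prop}
    (φ : SMap X M) (hR : ∀ n p q, R n p q ↔ φ n p = q) : IsSmoothOp X M R :=
  .of_retract (SMap.id X) (SMap.id X) φ (fun _ _ => rfl) fun n p q => by simp [hR]

/-! ### Groups of points -/

section Points

variable {G : Supergroup.{u}} {H : AbelianSupergroup.{u}}

/-- The map that is constantly the unit. -/
def Supergroup.constOne (G : Supergroup.{u}) (M : SuperManifold.{u}) : SMap M G.carrier :=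
  G.one.comp (SMap.toPoint M)

/-- The action on `A`-points. -/
@[reducible]
def SuperAction.distribMulAction (ρ : SuperAction G H) (n : ℕ) :
    DistribMulAction (G.carrier.pts n) (H.carrier.pts n) where
  smul g h := ρ.act n (g, h)
  one_smul h := ρ.one_act n h
  mul_smul g g' h := ρ.mul_act n g g' h
  smul_zero g := by
    have h := ρ.act_add n g 0 0
    rw [add_zero] at h
    exact left_eq_add.1 h
  smul_add g h h' := ρ.act_add n g h h'

end Points

end SuperGeometry

/-! ### The 3-supergroup of a normalized cocycle -/

namespace SuperGeometry

open Tricat Tricat.TricatBase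

variable {G : Supergroup.{u}} {H : AbelianSupergroup.{u}}

namespace Cochain4

/-- A cochain on `A`-points. -/
def onPts (c : Cochain4 G H) (n : ℕ) (f g h k : G.carrier.pts n) : H.carrier.pts n :=
  c n (f, g, h, k)

variable {c : Cochain4 G H} {ρ : SuperAction G H}

/-- The tricategory on `A`-points given by a normalized cocycle. -/
def tricategory (hc : c.IsNormalized) (hz : c.IsCocycle ρ) (n : ℕ) : Tricategory PUnit.{u + 1} :=
  letI := ρ.distribMulAction n
  -- The super cocycle condition at `n` is `IsCocycle₄` by unfolding the scalar action.
  shiftTricategory (c.onPts n) (hz n) (fun _ _ _ => hc _ _ _ _ _ (.inr (.inl rfl)))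
    (fun _ _ _ => hc _ _ _ _ _ (.inr (.inr (.inl rfl))))

/-- The inverses on `A`-points in the tricategory given by a normalized cocycle. -/
def inverses (hc : c.IsNormalized) (hz : c.IsCocycle ρ) (n : ℕ) :
    TricatInverses (tricategory hc hz n) :=
  letI := ρ.distribMulAction n
  shiftInverses (c.onPts n) (hz n) (fun _ _ _ => hc _ _ _ _ _ (.inr (.inl rfl)))
    (fun _ _ _ => hc _ _ _ _ _ (.inr (.inr (.inl rfl))))

/-- The cells of `Brane_π(G, H)` are the `A`-points of `braneGlob G H`. -/
def tricatOn (hc : c.IsNormalized) (hz : c.IsCocycle ρ) : TricatOn (braneGlob G H) where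
  tri n := tricategory hc hz n
  cell₁ {n} _ _ :=
    { toFun f := ⟨Shift.pt f, rfl, rfl⟩
      invFun p := (⟨p.1⟩ : Shift (G.carrier.pts n) (H.carrier.pts n))
      left_inv _ := rfl
      right_inv _ := rfl }
  cell₂ {n} _ _ {f g} :=
    { toFun α := ⟨Shift.pt f, rfl, congrArg Shift.pt (Shift.Hom₁.eq α)⟩
      -- Both source and target map are the identity of `G`, so a point `p` of this set of cells
      -- equals the points of both `f` and `g`.
      invFun p := (⟨congrArg Shift.mk (p.2.1.symm.trans p.2.2)⟩ : Shift.Hom₁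
        (G := G.carrier.pts n) (H := H.carrier.pts n) f g)
      left_inv _ := rfl
      right_inv p := Subtype.ext p.2.1.symm }
  cell₃ {n} _ _ {f _ _ _} :=
    { toFun Γ := ⟨(Shift.pt f, Shift.val (G := G.carrier.pts n) (H := H.carrier.pts n) Γ), rfl, rfl⟩
      invFun p := Shift.ofVal (G := G.carrier.pts n) (H := H.carrier.pts n) _ _ p.1.2
      left_inv _ := rfl
      right_inv p := Subtype.ext (Prod.ext p.2.1.symm rfl) }

end Cochain4

/-! The maps of supermanifolds underlying the structure of `Brane_π(G, H)`. -/

namespace BraneMap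

variable (G H)

/-- `(f, (g, h)) ↦ ((f, g), (f, h))` -/
def distribute (L M N : SuperManifold.{u}) :
    SMap (L.prod (M.prod N)) ((L.prod M).prod (L.prod N)) :=
  .pair (.pair (.fst _ _) (.comp (.fst _ _) (.snd _ _)))
    (.pair (.fst _ _) (.comp (.snd _ _) (.snd _ _)))

/-- `((f, g), (f', h)) ↦ (f, (g, h))` -/
def collect (L M N : SuperManifold.{u}) :
    SMap ((L.prod M).prod (L.prod N)) (L.prod (M.prod N)) :=
  .pair (.comp (.fst _ _) (.fst _ _))
    (.pair (.comp (.snd _ _) (.fst _ _)) (.comp (.snd _ _) (.snd _ _)))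

/-- `(g, h) ↦ ((g, h), (g, -h))` -/
def iso : SMap (G.carrier.prod H.carrier)
    ((G.carrier.prod H.carrier).prod (G.carrier.prod H.carrier)) :=
  .pair (.id _) (.pair (.fst _ _) (H.inv.comp (.snd _ _)))

/-- `g ↦ (g, 0)` -/
def zero : SMap G.carrier (G.carrier.prod H.carrier) :=
  .pair (.id _) (H.constOne _)

/-- `g ↦ ((g, 0), (g, 0))` -/
def isoZero : SMap G.carrier ((G.carrier.prod H.carrier).prod (G.carrier.prod H.carrier)) :=
  (iso G H).comp (zero G H)

/-- `((g, h), (g', h')) ↦ (g g', h + g h')` -/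
def mulSemidirect {G : Supergroup.{u}} {H : AbelianSupergroup.{u}} (ρ : SuperAction G H) :
    SMap ((G.carrier.prod H.carrier).prod (G.carrier.prod H.carrier))
      (G.carrier.prod H.carrier) :=
  .pair (G.mul.comp (.pair (.comp (.fst _ _) (.fst _ _)) (.comp (.fst _ _) (.snd _ _))))
    (H.mul.comp (.pair (.comp (.snd _ _) (.fst _ _))
      (ρ.act.comp (.pair (.comp (.fst _ _) (.fst _ _)) (.comp (.snd _ _) (.snd _ _))))))

/-- `g ↦ 1 g` -/
def oneMul : SMap G.carrier G.carrier := G.mul.comp (.pair (G.constOne _) (.id _))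

/-- `g ↦ g 1` -/
def mulOne : SMap G.carrier G.carrier := G.mul.comp (.pair (.id _) (G.constOne _))

/-- `(f, g, h) ↦ (f g) h` -/
def mulLeft : SMap (G.carrier.prod (G.carrier.prod G.carrier)) G.carrier :=
  G.mul.comp (.pair (G.mul.comp (.pair (.fst _ _) (.comp (.fst _ _) (.snd _ _))))
    (.comp (.snd _ _) (.snd _ _)))

/-- `(f, g, h) ↦ f (g h)` -/
def mulRight : SMap (G.carrier.prod (G.carrier.prod G.carrier)) G.carrier :=
  G.mul.comp (.pair (.fst _ _) (G.mul.comp (.snd _ _)))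

/-- `(f, g, h, k) ↦ ((f g) h) k` -/
def mulLeft₄ : SMap (G.carrier.prod (G.carrier.prod (G.carrier.prod G.carrier))) G.carrier :=
  G.mul.comp (.pair ((mulLeft G).comp (.pair (.fst _ _) (.pair (.comp (.fst _ _) (.snd _ _))
    (.comp (.fst _ _) (.comp (.snd _ _) (.snd _ _))))))
    (.comp (.snd _ _) (.comp (.snd _ _) (.snd _ _))))

end BraneMap

end SuperGeometry

/-! ### Smoothness of the structure maps -/

namespace SuperGeometry

open Tricat Tricat.TricatBase BraneMap

variable {G : Supergroup.{u}} {H : AbelianSupergroup.{u}} {c : Cochain4 G H} {ρ : SuperAction G H}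

namespace Cochain4

section Cells

variable (G H) in
/-- The object of `Brane_π(G, H)`. -/
def obj (n : ℕ) : (braneGlob G H).T0.pts n := PUnit.unit

variable (hc : c.IsNormalized) (hz : c.IsCocycle ρ) {n : ℕ}

/-- The morphism given by an `A`-point of `G`. -/
def mk₁ (g : G.carrier.pts n) : ((tricatOn hc hz).tri n).Hom (obj G H n) (obj G H n) :=
  (⟨g⟩ : Shift (G.carrier.pts n) (H.carrier.pts n))

/-- The 3-morphism between identities given by an `A`-point of `G × H`. -/
def mk₃ (p : (G.carrier.prod H.carrier).pts n) :
    𝟙 (mk₁ hc hz p.1) ⟶ 𝟙 (mk₁ hc hz p.1) :=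
  Shift.ofVal (G := G.carrier.pts n) (H := H.carrier.pts n) _ _ p.2

/-- Used to substitute along 2-morphisms, so that composable cells visibly lie over one point of
`G`. -/
theorem eq_of_hom {x y : (braneGlob G H).T0.pts n} {f g : ((tricatOn hc hz).tri n).Hom x y}
    (α : f ⟶ g) : f = g :=
  Shift.Hom₁.eq (G := G.carrier.pts n) (H := H.carrier.pts n) α

end Cells

/-- The super tricategory `Brane_π(G, H)`. -/
def superTricategory (hc : c.IsNormalized) (hz : c.IsCocycle ρ) :
    SuperTricategory (braneGlob G H) where
  toTricatOn := tricatOn hc hz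
  smooth_one := .of_total G.one fun n p q => eq_comm
  smooth_id₂ := .of_total
    (.id G.carrier)
    fun n p q => by
      constructor
      · rintro ⟨x, y, f, rfl, rfl⟩
        rfl
      · rintro rfl
        exact ⟨_, _, mk₁ hc hz p, rfl, rfl⟩
  smooth_id₃ := .of_total
    (zero G H)
    fun n p q => by
      constructor
      · rintro ⟨x, y, f, g, α, rfl, rfl⟩
        rfl
      · rintro rfl
        exact ⟨_, _, mk₁ hc hz p, _, 𝟙 _, rfl, rfl⟩
  -- Composable 3-morphisms share their component in `G`, so the pullback is `G × (H × H)`, a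
  -- retract of `(G × H)²`.
  smooth_comp₂₃ := .of_retract
    (distribute _ _ _)
    (collect _ _ _)
    (.pair (.fst _ _) (H.mul.comp (.snd _ _)))
    (fun _ _ => rfl)
    fun n p q => by
      constructor
      · rintro ⟨x, y, f, g, α, β, γ, Γ, Γ', rfl, rfl⟩
        exact ⟨((tricatOn hc hz).c₁ f, ((tricatOn hc hz).c₃ Γ).2, ((tricatOn hc hz).c₃ Γ').2), rfl,
          rfl⟩
      · rintro ⟨p, rfl, rfl⟩
        exact ⟨_, _, mk₁ hc hz p.1, mk₁ hc hz p.1, 𝟙 _, 𝟙 _, 𝟙 _, mk₃ hc hz (p.1, p.2.1),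
          mk₃ hc hz (p.1, p.2.2), rfl, rfl⟩
  -- Composable 2-morphisms are the same point of `G`; the pullback is the diagonal.
  smooth_comp₁₂ := .of_retract
    (.pair (.id _) (.id _))
    (.fst _ _)
    (.id G.carrier)
    (fun _ _ => rfl)
    fun n p q => by
      constructor
      · rintro ⟨x, y, f, g, h, α, β, rfl, rfl⟩
        obtain rfl := eq_of_hom hc hz α
        exact ⟨(tricatOn hc hz).c₁ f, rfl, rfl⟩
      · rintro ⟨p, rfl, rfl⟩
        exact ⟨_, _, mk₁ hc hz p, mk₁ hc hz p, mk₁ hc hz p, 𝟙 _, 𝟙 _, rfl, rfl⟩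
  smooth_comp₁₃ := .of_retract
    (distribute _ _ _)
    (collect _ _ _)
    (.pair (.fst _ _) (H.mul.comp (.snd _ _)))
    (fun _ _ => rfl)
    fun n p q => by
      constructor
      · rintro ⟨x, y, f, g, h, α, α', β, β', Γ, Γ', rfl, rfl⟩
        obtain rfl := eq_of_hom hc hz α
        exact ⟨((tricatOn hc hz).c₁ f, ((tricatOn hc hz).c₃ Γ).2, ((tricatOn hc hz).c₃ Γ').2), rfl,
          rfl⟩
      · rintro ⟨p, rfl, rfl⟩
        exact ⟨_, _, mk₁ hc hz p.1, mk₁ hc hz p.1, mk₁ hc hz p.1, 𝟙 _, 𝟙 _, 𝟙 _, 𝟙 _, mk₃ hc hz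
          (p.1, p.2.1), mk₃ hc hz (p.1, p.2.2), rfl, rfl⟩
  smooth_assoc := .of_retract
    (.pair (.id _) (.pair (.id _) (.id _)))
    (.fst _ _)
    (isoZero G H)
    (fun _ _ => rfl)
    fun n p q => by
      constructor
      · rintro ⟨x, y, f, g, h, k, α, β, γ, rfl, rfl⟩
        obtain rfl := eq_of_hom hc hz α
        obtain rfl := eq_of_hom hc hz β
        exact ⟨(tricatOn hc hz).c₁ f, rfl, rfl⟩
      · rintro ⟨p, rfl, rfl⟩
        exact ⟨_, _, mk₁ hc hz p, mk₁ hc hz p, mk₁ hc hz p, mk₁ hc hz p, 𝟙 _, 𝟙 _, 𝟙 _, rfl, rfl⟩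
  smooth_left := .of_total
    (isoZero G H)
    fun n p q => by
      constructor
      · rintro ⟨x, y, f, g, α, rfl, rfl⟩
        rfl
      · rintro rfl
        exact ⟨_, _, mk₁ hc hz p, mk₁ hc hz p, 𝟙 _, rfl, rfl⟩
  smooth_right := .of_total
    (isoZero G H)
    fun n p q => by
      constructor
      · rintro ⟨x, y, f, g, α, rfl, rfl⟩
        rfl
      · rintro rfl
        exact ⟨_, _, mk₁ hc hz p, mk₁ hc hz p, 𝟙 _, rfl, rfl⟩
  smooth_comp₀₁ := .of_total
    G.mul
    fun n p q => by
      constructor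
      · rintro ⟨x, y, z, f, g, rfl, rfl⟩
        rfl
      · rintro rfl
        exact ⟨_, _, _, mk₁ hc hz p.1, mk₁ hc hz p.2, rfl, rfl⟩
  smooth_comp₀₂ := .of_total
    G.mul
    fun n p q => by
      constructor
      · rintro ⟨x, y, z, f, f', g, g', α, β, rfl, rfl⟩
        rfl
      · rintro rfl
        exact ⟨_, _, _, mk₁ hc hz p.1, mk₁ hc hz p.1, mk₁ hc hz p.2, mk₁ hc hz p.2, 𝟙 _, 𝟙 _, rfl,
          rfl⟩
  smooth_comp₀₃ := .of_total
    (mulSemidirect ρ)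
    fun n p q => by
      constructor
      · rintro ⟨x, y, z, f, f', g, g', α, α', β, β', Γ, Γ', rfl, rfl⟩
        rfl
      · rintro rfl
        exact ⟨_, _, _, mk₁ hc hz p.1.1, mk₁ hc hz p.1.1, mk₁ hc hz p.2.1, mk₁ hc hz p.2.1, 𝟙 _,
          𝟙 _, 𝟙 _, 𝟙 _, mk₃ hc hz p.1, mk₃ hc hz p.2, rfl, rfl⟩
  smooth_oId := .of_total
    ((isoZero G H).comp G.mul)
    fun n p q => by
      constructor
      · rintro ⟨x, y, z, f, g, rfl, rfl⟩
        rfl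
      · rintro rfl
        exact ⟨_, _, _, mk₁ hc hz p.1, mk₁ hc hz p.2, rfl, rfl⟩
  -- The domain is a product of two diagonals, one for each of the two composable pairs.
  smooth_oComp := .of_retract
    (.pair (.pair (.fst _ _) (.fst _ _)) (.pair (.snd _ _) (.snd _ _)))
    (.pair (.comp (.fst _ _) (.fst _ _)) (.comp (.fst _ _) (.snd _ _)))
    ((isoZero G H).comp G.mul)
    (fun _ _ => rfl)
    fun n p q => by
      constructor
      · rintro ⟨x, y, z, f, f', f'', g, g', g'', α, α', β, β', rfl, rfl⟩
        obtain rfl := eq_of_hom hc hz α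
        obtain rfl := eq_of_hom hc hz β
        exact ⟨((tricatOn hc hz).c₁ f, (tricatOn hc hz).c₁ g), rfl, rfl⟩
      · rintro ⟨p, rfl, rfl⟩
        exact ⟨_, _, _, mk₁ hc hz p.1, mk₁ hc hz p.1, mk₁ hc hz p.1, mk₁ hc hz p.2, mk₁ hc hz p.2,
          mk₁ hc hz p.2, 𝟙 _, 𝟙 _, 𝟙 _, 𝟙 _, rfl, rfl⟩
  -- Cells are recorded by the point of their source morphism. Hence the associator yields `(f g) h`
  -- and its inverse `f (g h)`, two expressions that are equal only by associativity; the same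
  -- convention fixes the `G`-component in the remaining fields.
  smooth_a := .of_total
    (.pair (mulLeft G) (mulRight G))
    fun n p q => by
      constructor
      · rintro ⟨x, y, z, w, f, g, h, rfl, rfl⟩
        rfl
      · rintro rfl
        exact ⟨_, _, _, _, mk₁ hc hz p.1, mk₁ hc hz p.2.1, mk₁ hc hz p.2.2, rfl, rfl⟩
  smooth_aAdj := .of_total
    (.pair ((isoZero G H).comp (mulLeft G)) ((isoZero G H).comp (mulRight G)))
    fun n p q => by
      constructor
      · rintro ⟨x, y, z, w, f, g, h, rfl, rfl⟩
        rfl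
      · rintro rfl
        exact ⟨_, _, _, _, mk₁ hc hz p.1, mk₁ hc hz p.2.1, mk₁ hc hz p.2.2, rfl, rfl⟩
  smooth_aNat := .of_total
    (.pair ((isoZero G H).comp (mulLeft G)) ((isoZero G H).comp (mulRight G)))
    fun n p q => by
      constructor
      · rintro ⟨x, y, z, w, f, f', g, g', h, h', α, β, γ, rfl, rfl⟩
        rfl
      · rintro rfl
        exact ⟨_, _, _, _, mk₁ hc hz p.1, mk₁ hc hz p.1, mk₁ hc hz p.2.1, mk₁ hc hz p.2.1,
          mk₁ hc hz p.2.2, mk₁ hc hz p.2.2, 𝟙 _, 𝟙 _, 𝟙 _, rfl, rfl⟩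
  smooth_l := .of_total
    (.pair (oneMul G) (.id G.carrier))
    fun n p q => by
      constructor
      · rintro ⟨x, y, f, rfl, rfl⟩
        rfl
      · rintro rfl
        exact ⟨_, _, mk₁ hc hz p, rfl, rfl⟩
  smooth_lAdj := .of_total
    (.pair ((isoZero G H).comp (oneMul G)) (isoZero G H))
    fun n p q => by
      constructor
      · rintro ⟨x, y, f, rfl, rfl⟩
        rfl
      · rintro rfl
        exact ⟨_, _, mk₁ hc hz p, rfl, rfl⟩
  smooth_lNat := .of_total
    (.pair ((isoZero G H).comp (oneMul G)) (isoZero G H))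
    fun n p q => by
      constructor
      · rintro ⟨x, y, f, f', α, rfl, rfl⟩
        rfl
      · rintro rfl
        exact ⟨_, _, mk₁ hc hz p, mk₁ hc hz p, 𝟙 _, rfl, rfl⟩
  smooth_r := .of_total
    (.pair (mulOne G) (.id G.carrier))
    fun n p q => by
      constructor
      · rintro ⟨x, y, f, rfl, rfl⟩
        rfl
      · rintro rfl
        exact ⟨_, _, mk₁ hc hz p, rfl, rfl⟩
  smooth_rAdj := .of_total
    (.pair ((isoZero G H).comp (mulOne G)) (isoZero G H))
    fun n p q => by
      constructor
      · rintro ⟨x, y, f, rfl, rfl⟩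
        rfl
      · rintro rfl
        exact ⟨_, _, mk₁ hc hz p, rfl, rfl⟩
  smooth_rNat := .of_total
    (.pair ((isoZero G H).comp (mulOne G)) (isoZero G H))
    fun n p q => by
      constructor
      · rintro ⟨x, y, f, f', α, rfl, rfl⟩
        rfl
      · rintro rfl
        exact ⟨_, _, mk₁ hc hz p, mk₁ hc hz p, 𝟙 _, rfl, rfl⟩
  smooth_pi := .of_total
    ((iso G H).comp (.pair (mulLeft₄ G) c))
    fun n p q => by
      constructor
      · rintro ⟨x, y, z, w, v, f, g, h, k, rfl, rfl⟩
        rfl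
      · rintro rfl
        exact ⟨_, _, _, _, _, mk₁ hc hz p.1, mk₁ hc hz p.2.1, mk₁ hc hz p.2.2.1, mk₁ hc hz p.2.2.2,
          rfl, rfl⟩
  smooth_lam := .of_total
    ((isoZero G H).comp (G.mul.comp (.pair ((oneMul G).comp (.fst _ _)) (.snd _ _))))
    fun n p q => by
      constructor
      · rintro ⟨x, y, z, f, g, rfl, rfl⟩
        rfl
      · rintro rfl
        exact ⟨_, _, _, mk₁ hc hz p.1, mk₁ hc hz p.2, rfl, rfl⟩
  smooth_mu := .of_total
    ((isoZero G H).comp (G.mul.comp (.pair ((mulOne G).comp (.fst _ _)) (.snd _ _))))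
    fun n p q => by
      constructor
      · rintro ⟨x, y, z, f, g, rfl, rfl⟩
        rfl
      · rintro rfl
        exact ⟨_, _, _, mk₁ hc hz p.1, mk₁ hc hz p.2, rfl, rfl⟩
  smooth_rho := .of_total
    ((isoZero G H).comp ((mulOne G).comp G.mul))
    fun n p q => by
      constructor
      · rintro ⟨x, y, z, f, g, rfl, rfl⟩
        rfl
      · rintro rfl
        exact ⟨_, _, _, mk₁ hc hz p.1, mk₁ hc hz p.2, rfl, rfl⟩

/-- The 3-supergroup `Brane_π(G, H)`. -/
def threeSupergroup (hc : c.IsNormalized) (hz : c.IsCocycle ρ) :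
    ThreeSupergroup (braneGlob G H) where
  toSuperTricategory := superTricategory hc hz
  one_object _ := ⟨⟨⟩, rfl, fun _ _ => rfl⟩
  inverses n := inverses hc hz n
  smooth_inv₃ := .of_total
    (.pair (.fst _ _) (H.inv.comp (.snd _ _)))
    fun n p q => by
      constructor
      · rintro ⟨x, y, f, g, α, β, Γ, rfl, rfl⟩
        rfl
      · rintro rfl
        exact ⟨_, _, mk₁ hc hz p.1, mk₁ hc hz p.1, 𝟙 _, 𝟙 _, mk₃ hc hz p, rfl, rfl⟩
  smooth_inv₂ := .of_total
    (.pair (.id _) (.pair (isoZero G H) (isoZero G H)))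
    fun n p q => by
      constructor
      · rintro ⟨x, y, f, g, α, rfl, rfl⟩
        -- The inverse is recorded by its source, the target of `α`.
        obtain rfl := eq_of_hom hc hz α
        rfl
      · rintro rfl
        exact ⟨_, _, mk₁ hc hz p, _, 𝟙 _, rfl, rfl⟩
  smooth_inv₁ := .of_total
    G.inv
    fun n p q => by
      constructor
      · rintro ⟨x, y, f, rfl, rfl⟩
        rfl
      · rintro rfl
        exact ⟨_, _, mk₁ hc hz p, rfl, rfl⟩
  smooth_eps := .of_total
    (.pair (.pair (G.mul.comp (.pair G.inv (.id _))) (G.constOne _)) (.pair ((isoZero G H).comp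
      (G.mul.comp (.pair G.inv (.id _)))) ((isoZero G H).comp (G.constOne _))))
    fun n p q => by
      constructor
      · rintro ⟨x, y, f, rfl, rfl⟩
        rfl
      · rintro rfl
        exact ⟨_, _, mk₁ hc hz p, rfl, rfl⟩
  smooth_eta := .of_total
    (.pair (.pair (G.constOne _) (G.mul.comp (.pair (.id _) G.inv))) (.pair ((isoZero G H).comp
      (G.constOne _)) ((isoZero G H).comp (G.mul.comp (.pair (.id _) G.inv)))))
    fun n p q => by
      constructor
      · rintro ⟨x, y, f, rfl, rfl⟩
        rfl
      · rintro rfl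
        exact ⟨_, _, mk₁ hc hz p, rfl, rfl⟩
  smooth_Phi := .of_total
    ((iso G H).comp (.pair (.id _) (H.inv.comp (c.comp (.pair (.id _) (.pair G.inv (.pair
      (.id _) G.inv)))))))
    fun n p q => by
      constructor
      · rintro ⟨x, y, f, rfl, rfl⟩
        rfl
      · rintro rfl
        exact ⟨_, _, mk₁ hc hz p, rfl, rfl⟩
  smooth_Theta := .of_total
    ((isoZero G H).comp G.inv)
    fun n p q => by
      constructor
      · rintro ⟨x, y, f, rfl, rfl⟩
        rfl
      · rintro rfl
        exact ⟨_, _, mk₁ hc hz p, rfl, rfl⟩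

end Cochain4

end SuperGeometry

/-! ### Recognition of the brane structure, and the converse -/

namespace SuperGeometry

open Tricat Tricat.TricatBase

variable {G : Supergroup.{u}} {H : AbelianSupergroup.{u}} {c : Cochain4 G H} {ρ : SuperAction G H}

theorem Cochain4.isBrane_threeSupergroup (hc : c.IsNormalized) (hz : c.IsCocycle ρ) :
    (threeSupergroup hc hz).IsBrane ρ c where
  one _ _ := rfl
  id₂ _ _ _ _ := rfl
  id₃ _ _ _ _ _ _ := ⟨rfl, rfl⟩
  comp₂₃ _ _ _ _ _ _ _ _ _ _ := rfl
  comp₁₂ _ _ _ _ _ _ _ _ := rfl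
  comp₁₃ _ _ _ _ _ _ _ _ _ _ _ _ := rfl
  comp₀₁ _ _ _ _ _ _ := rfl
  comp₀₂ _ _ _ _ _ _ _ _ _ _ := rfl
  comp₀₃ _ _ _ _ _ _ _ _ _ _ _ _ _ _ := ⟨rfl, rfl⟩
  assoc₁ _ _ _ _ _ _ _ _ _ _ := rfl
  left₁ _ _ _ _ _ _ := rfl
  right₁ _ _ _ _ _ _ := rfl
  oId _ _ _ _ _ _ := rfl
  oComp _ _ _ _ _ _ _ _ _ _ _ _ _ _ := rfl
  a _ _ _ _ _ _ _ _ := ⟨rfl, rfl⟩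
  aNat _ _ _ _ _ _ _ _ _ _ _ _ _ _ := ⟨rfl, rfl⟩
  l _ _ _ _ := ⟨rfl, rfl⟩
  lNat _ _ _ _ _ _ := ⟨rfl, rfl⟩
  r _ _ _ _ := ⟨rfl, rfl⟩
  rNat _ _ _ _ _ _ := ⟨rfl, rfl⟩
  triangulators _ _ _ _ _ _ := ⟨rfl, rfl, rfl⟩
  pentagonator _ _ _ _ _ _ _ _ _ _ := rfl
  inv₃ _ _ _ _ _ _ _ _ := ⟨rfl, rfl⟩
  -- Here the recorded points are those of the two ends of `α`, which agree only propositionally.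
  inv₂ _ _ _ _ _ α := ⟨congrArg Shift.pt (eq_of_hom hc hz α).symm, rfl, rfl⟩
  inv₁ _ _ _ _ := rfl
  eps _ _ _ _ := ⟨rfl, rfl⟩
  eta _ _ _ _ := ⟨rfl, rfl⟩
  Phi _ _ _ _ := rfl
  Theta _ _ _ _ := rfl

namespace ThreeSupergroup

variable {S : ThreeSupergroup (braneGlob G H)}

/-- The source maps are the projection `G × H → G` and the identity of `G`. This replaces the acting
element in the composition of `G ⋉ H` by the source morphism, as `TricatValue` requires. -/
theorem gPart₃_eq {n : ℕ} {x y : (braneGlob G H).T0.pts n} {f g : (S.tri n).Hom x y} {α β : f ⟶ g}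
    (Γ : α ⟶ β) : S.gPart₃ Γ = S.gPart f :=
  (S.cell₃ Γ).2.1.trans (S.cell₂ α).2.1

/-- The value of 3-morphisms in a 3-supergroup with the structure maps of `Brane_π(G, H)`. -/
def IsBrane.value (h : S.IsBrane ρ c) (n : ℕ) :
    letI := ρ.distribMulAction n
    TricatValue (S.tri n).toTricatCells (G.carrier.pts n) (H.carrier.pts n) :=
  letI := ρ.distribMulAction n
  { pt := S.gPart
    val := S.hPart
    c := c.onPts n
    pt_o := h.comp₀₁ n _ _ _
    pt_one := h.one n
    id α := (h.id₃ n _ _ _ _ α).2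
    comp := h.comp₂₃ n _ _ _ _ _ _ _
    -- Whiskering is composition at a 1-cell with an identity 3-morphism, whose value is zero.
    whiskerLeft α _ _ Γ := by
      have h' := h.comp₁₃ n _ _ _ _ _ _ _ _ _ (𝟙 α) Γ
      rwa [id_whiskerRight, Category.id_comp, (h.id₃ n _ _ _ _ α).2, zero_add] at h'
    whiskerRight Γ β := by
      have h' := h.comp₁₃ n _ _ _ _ _ _ _ _ _ Γ (𝟙 β)
      rwa [whiskerLeft_id, Category.comp_id, (h.id₃ n _ _ _ _ β).2, add_zero] at h'
    associator := h.assoc₁ n _ _ _ _ _ _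
    leftUnitor := h.left₁ n _ _ _ _
    rightUnitor := h.right₁ n _ _ _ _
    o₃ Γ Γ' := by
      rw [(h.comp₀₃ n _ _ _ _ _ _ _ _ _ _ _ Γ Γ').2, gPart₃_eq]
      rfl
    oId := h.oId n _ _ _
    oComp := h.oComp n _ _ _ _ _ _ _ _ _
    aUnit f g k := (h.a n _ _ _ _ f g k).1
    aCounit f g k := (h.a n _ _ _ _ f g k).2
    aNat α β γ := (h.aNat n _ _ _ _ _ _ _ _ _ _ α β γ).1
    aNat' α β γ := (h.aNat n _ _ _ _ _ _ _ _ _ _ α β γ).2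
    lUnit f := (h.l n _ _ f).1
    lCounit f := (h.l n _ _ f).2
    lNat α := (h.lNat n _ _ _ _ α).1
    lNat' α := (h.lNat n _ _ _ _ α).2
    rUnit f := (h.r n _ _ f).1
    rCounit f := (h.r n _ _ f).2
    rNat α := (h.rNat n _ _ _ _ α).1
    rNat' α := (h.rNat n _ _ _ _ α).2
    lam f g := (h.triangulators n _ _ _ f g).1
    mu f g := (h.triangulators n _ _ _ f g).2.1
    rho f g := (h.triangulators n _ _ _ f g).2.2
    pi := h.pentagonator n _ _ _ _ _ }

/-- The source and target conditions are vacuous because the supermanifold of objects is a point,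
and `cell₁` is a bijection onto the points satisfying them. -/
theorem exists_gPart_eq {n : ℕ} (x y : (braneGlob G H).T0.pts n) (g : G.carrier.pts n) :
    ∃ f : (S.tri n).Hom x y, S.gPart f = g :=
  ⟨S.cell₁.symm ⟨g, rfl, rfl⟩, congrArg Subtype.val (S.cell₁.apply_symm_apply _)⟩

/-- Five arbitrary points of `G` are realized as composable endomorphisms of one object; the value
of the pentagonator identity at them is the cocycle equation. -/
theorem IsBrane.isCocycle (h : S.IsBrane ρ c) : c.IsCocycle ρ := by
  intro n g₁ g₂ g₃ g₄ g₅
  let := ρ.distribMulAction n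
  obtain ⟨x, -⟩ := S.one_object n
  obtain ⟨f₁, rfl⟩ := S.exists_gPart_eq x x g₁
  obtain ⟨f₂, rfl⟩ := S.exists_gPart_eq x x g₂
  obtain ⟨f₃, rfl⟩ := S.exists_gPart_eq x x g₃
  obtain ⟨f₄, rfl⟩ := S.exists_gPart_eq x x g₄
  obtain ⟨f₅, rfl⟩ := S.exists_gPart_eq x x g₅
  exact ((h.value n).pentagonator_iff f₁ f₂ f₃ f₄ f₅).1
    (congrArg _ ((S.tri n).pentagonator f₁ f₂ f₃ f₄ f₅))

end ThreeSupergroup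

end SuperGeometry

end

theorem mainTheorem2 (G : SuperGeometry.Supergroup.{u}) (H : SuperGeometry.AbelianSupergroup.{u})
    (ρ : SuperGeometry.SuperAction G H) (π : SuperGeometry.Cochain4 G H)
    (hπ : π.IsNormalized) :
    π.IsCocycle ρ ↔
      ∃ S : SuperGeometry.ThreeSupergroup (SuperGeometry.braneGlob G H), S.IsBrane ρ π :=
  ⟨fun h => ⟨_, SuperGeometry.Cochain4.isBrane_threeSupergroup hπ h⟩, fun ⟨_, h⟩ => h.isCocycle⟩
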